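/- Let $K\ge 2$ be an integer and let $\mathbb T$ be the set of vertices of the regular rooted tree with branching number $K$ (every vertex has exactly $K$ children); write $|x|$ for the distance of $x\in\mathbb T$ to the root. Let $V:\mathbb T\to\mathbb R$ be radial, i.e. $V_x=v_{|x|}$ for some $v:\mathbb N_0\to\mathbb R$ (not necessarily bounded). On $\ell^2(\mathbb T)$ let $H=T+V$ be the self-adjoint operator with maximal domain, where $T$ is the adjacency operator of the tree, $(T\psi)(x)=\sum_{y\sim x}\psi(y)$, and on $\ell^2(\mathbb N_0)$ let $h^+=T+v/\sqrt K$ be the self-adjoint operator with maximal domain, where here $T$ is the adjacency operator of the half-line, in which $m\sim n$ if and only if $|m-n|=1$. For a self-adjoint operator $A$, let $\sigma_{\rm ac}(A)$ (resp. $\sigma_{\rm sing}(A)$) be the spectrum of the restriction of $A$ to the subspace of the vectors whose spectral measure is absolutely continuous (resp. singular) with respect to Lebesgue measure; equivalently, it is the closure of the union of the supports of the spectral measures of these vectors. Then $$\sigma_{\rm ac}(H)=\sqrt K\,\sigma_{\rm ac}(h^+)\qquad\text{and}\qquad \sigma_{\rm sing}(H)\supseteq\sqrt K\,\sigma_{\rm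 sing}(h^+).$$ -/

import Mathlib

open scoped ENNReal lp
open MeasureTheory

noncomputable section

/-! ### Spectral measures and spectral components of self-adjoint operators -/

/-- `μ` is the spectral measure of the vector `ψ` for the (in general unbounded) self-adjoint
operator `A`: the finite Borel measure on `ℝ` with
`⟪ψ, (A - z)⁻¹ ψ⟫ = ∫ (t - z)⁻¹ dμ(t)` for every non-real `z`, where `φ` is `(A - z)⁻¹ ψ`. -/
def IsSpectralMeasure {E : Type*} [NormedAddCommGroup E] [InnerProductSpace ℂ E]
    (A : E →ₗ.[ℂ] E) (ψ : E) (μ : Measure ℝ) : Prop :=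
  IsFiniteMeasure μ ∧
    ∀ z : ℂ, z.im ≠ 0 → ∃ φ : A.domain, A φ - z • (φ : E) = ψ ∧
      inner ℂ ψ (φ : E) = ∫ t : ℝ, ((t : ℂ) - z)⁻¹ ∂μ

/-- The absolutely continuous spectrum of a self-adjoint operator, i.e. the spectrum of its
restriction to the subspace of the vectors whose spectral measure is absolutely continuous with
respect to Lebesgue measure: the closure of the union of the supports of the spectral measures of
these vectors. -/
def acSpectrum {E : Type*} [NormedAddCommGroup E] [InnerProductSpace ℂ E]
    (A : E →ₗ.[ℂ] E) : Set ℝ :=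
  closure {t : ℝ | ∃ (ψ : E) (μ : Measure ℝ),
    IsSpectralMeasure A ψ μ ∧ μ ≪ volume ∧ t ∈ μ.support}

/-- The singular spectrum of a self-adjoint operator, i.e. the spectrum of its restriction to the
subspace of the vectors whose spectral measure is singular with respect to Lebesgue measure
(eigenvalues and singular continuous spectrum together). -/
def singSpectrum {E : Type*} [NormedAddCommGroup E] [InnerProductSpace ℂ E]
    (A : E →ₗ.[ℂ] E) : Set ℝ :=
  closure {t : ℝ | ∃ (ψ : E) (μ : Measure ℝ),
    IsSpectralMeasure A ψ μ ∧ μ ⟂ₘ volume ∧ t ∈ μ.support}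

/-! ### Schrödinger operators on graphs -/

/-- The formal action of `T + q` on all functions on the vertices, where `T` is the adjacency
matrix of `G`: `((T + q) f) x = ∑_{y ∼ x} f y + q x * f x`. -/
def formalSchrodinger {X : Type*} (G : SimpleGraph X) [G.LocallyFinite] (q : X → ℝ) :
    (X → ℂ) →ₗ[ℂ] (X → ℂ) where
  toFun f x := (∑ y ∈ G.neighborFinset x, f y) + (q x : ℂ) * f x
  map_add' f g := by
    funext x
    simp only [Pi.add_apply, Finset.sum_add_distrib]
    ring
  map_smul' c f := by
    funext x
    simp only [Pi.smul_apply, smul_eq_mul, RingHom.id_apply, ← Finset.mul_sum]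
    ring

/-- The Schrödinger operator `T + q` in `ℓ²(X)`, on its maximal domain
`{ψ ∈ ℓ²(X) | (T + q) ψ ∈ ℓ²(X)}`. When the degrees of `G` are bounded, `T` is a bounded
operator and this is the domain `{ψ ∈ ℓ²(X) | q ψ ∈ ℓ²(X)}` of multiplication by `q`. -/
def schrodinger {X : Type*} (G : SimpleGraph X) [G.LocallyFinite] (q : X → ℝ) :
    ℓ²(X, ℂ) →ₗ.[ℂ] ℓ²(X, ℂ) where
  domain :=
    { carrier := {ψ | Memℓp (formalSchrodinger G q (ψ : X → ℂ)) 2}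
      add_mem' := fun {ψ φ} hψ hφ => by
        have h := Memℓp.add hψ hφ
        rwa [← map_add] at h
      zero_mem' := by
        show Memℓp (formalSchrodinger G q (0 : X → ℂ)) 2
        rw [map_zero]
        exact zero_memℓp
      smul_mem' := fun c ψ hψ => by
        have h := Memℓp.const_smul hψ c
        rwa [← map_smul] at h }
  toFun :=
    { toFun := fun ψ => ⟨formalSchrodinger G q ((ψ : ℓ²(X, ℂ)) : X → ℂ), ψ.2⟩
      map_add' := fun ψ φ => Subtype.ext (map_add (formalSchrodinger G q) _ _)
      map_smul' := fun c ψ => Subtype.ext (map_smul (formalSchrodinger G q) c _) }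

/-! ### The regular rooted tree and the half-line -/

/-- The regular rooted tree with branching number `K`. A vertex is the list of the labels of the
edges on the path from it to the root `[]`; the children of `x` are the `K` vertices `a :: x`, and
the distance `|x|` to the root is `x.length`. -/
def rootedTree (K : ℕ) : SimpleGraph (List (Fin K)) where
  Adj x y := (∃ a, y = a :: x) ∨ (∃ a, x = a :: y)
  symm := ⟨fun _ _ h => h.symm⟩
  loopless := ⟨fun x h => by
    rcases h with ⟨a, h⟩ | ⟨a, h⟩ <;> simpa using congrArg List.length h⟩

instance rootedTreeLocallyFinite (K : ℕ) : (rootedTree K).LocallyFinite := fun x =>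
  Set.Finite.fintype <| by
    refine ((Set.finite_range fun a : Fin K => a :: x).union
      (Set.finite_singleton x.tail)).subset ?_
    rintro y (⟨a, rfl⟩ | ⟨a, rfl⟩)
    · exact Or.inl ⟨a, rfl⟩
    · exact Or.inr rfl

/-- The half-line `ℕ₀`, with `m` and `n` adjacent if and only if `|m - n| = 1`. -/
def halfLine : SimpleGraph ℕ where
  Adj m n := n = m + 1 ∨ m = n + 1
  symm := ⟨fun _ _ h => h.symm⟩
  loopless := ⟨fun n h => by omega⟩

instance halfLineLocallyFinite : halfLine.LocallyFinite := fun n =>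
  Set.Finite.fintype <| by
    refine (Set.finite_Iic (n + 1)).subset ?_
    rintro m (h | h) <;> simp only [Set.mem_Iic] <;> omega

end

/-!
Write `s = √K` and `h_n` for the half-line operator with the shifted potential `j ↦ v (n + j) / s`, so
that `h⁺ = h_0`. A profile of generation `n` (`IsProfile`) is a function on the tree that vanishes
before generation `n`, is inherited by descendants from generation `n` on, and sums to zero over the
children of each vertex of generation `n - 1`. Multiplying radial functions by a profile and rescaling
generation `n + j` by `K^(-j/2)` gives an isometry from `ℓ²(ℕ)` to `ℓ²` of the tree which intertwines
`s h_n` with `H` (`IsProfile.intertwines`), since the cancellation decouples the subtrees from their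
ancestors. The constant profile gives a copy of `s h⁺` inside `H`, and spectral measures are
transported along intertwining isometries (`Intertwines.isSpectralMeasure_map`). This proves
`s σ_ac(h⁺) ⊆ σ_ac(H)` and the inclusion of the singular spectra.

For `σ_ac(H) ⊆ s σ_ac(h⁺)`, suppose that an absolutely continuous spectral measure of `H` charges the
complement `O` of `s σ_ac(h⁺)`, and let `χ` be the nonzero vector whose spectral measure is its
restriction to `O`. The ranges of the isometries are jointly total
(`eq_zero_of_adjoint_isometry_eq_zero`), so the component of `χ` along some profile is nonzero; its
spectral measure with respect to `h_n` is absolutely continuous and lives off `σ_ac(h⁺)`. This is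
excluded by `ae_rnDeriv_shift_eq_zero` and `measure_eq_zero_of_ae_rnDeriv_eq_zero`:

* The Green functions `m₀` of `h_n` and `m₁` of `h_{n+1}` at the origin satisfy
  `m₀ (q₀ - z - m₁) = 1` (`green_mul_green_shift`). Comparing imaginary parts near the real axis, the
  spectral measure of `δ₀` for `h_{n+1}` has zero density wherever the one for `h_n` has
  (`ae_rnDeriv_eq_zero_of_stieltjes_relation`); what is needed is that a function with positive
  imaginary part tends to infinity vertically only over a null set, which follows from Kolmogorov's
  estimate (`integral_sqrt_norm_le`). So all these measures have zero density off `σ_ac(h⁺)`.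
* `δ₀` is cyclic for `h_n` (`eq_zero_of_inner_delta_resolventOp`), and vectors with mutually singular
  spectral measures generate orthogonal cyclic subspaces
  (`IsSelfAdjointOp.inner_resolventOp_eq_zero`). So no vector can have a nonzero absolutely continuous
  spectral measure living where the density for `δ₀` vanishes.

The facts needed about spectral measures of unbounded operators are obtained from the continuous
functional calculus of the bounded normal operator `(A - i)⁻¹` and the Riesz-Markov-Kakutani theorem
(`exists_measure_normalCalculus`), transported to the line by `w ↦ w⁻¹ + i`. That a spectral measure
is unique is the inversion of the Stieltjes transform (`measure_eq_of_stieltjes_eq`).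
-/

/-! ### Resolvents of self-adjoint operators -/

section Resolvent

variable {E : Type*} [NormedAddCommGroup E] [InnerProductSpace ℂ E]

/-- Self-adjointness of a possibly unbounded operator in the form used for the functional calculus:
the operator is symmetric and `A - z` is onto for every non-real `z`. -/
structure IsSelfAdjointOp (A : E →ₗ.[ℂ] E) : Prop where
  symm : ∀ φ χ : A.domain, inner ℂ (A φ) (χ : E) = inner ℂ (φ : E) (A χ)
  surj : ∀ z : ℂ, z.im ≠ 0 → ∀ ψ : E, ∃ φ : A.domain, A φ - z • (φ : E) = ψ

/-- For a symmetric operator, `A - z` is bounded below by `|Im z|`. -/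
lemma abs_im_mul_norm_le_of_symm {A : E →ₗ.[ℂ] E}
    (hA : ∀ φ χ : A.domain, inner ℂ (A φ) (χ : E) = inner ℂ (φ : E) (A χ)) (z : ℂ) (φ : A.domain) :
    |z.im| * ‖(φ : E)‖ ≤ ‖A φ - z • (φ : E)‖ := by
  have h1 : (inner ℂ (φ : E) (A φ)).im = 0 := by
    rw [← Complex.conj_eq_iff_im, inner_conj_symm, hA]
  have h2 : (inner ℂ (φ : E) (A φ - z • (φ : E))).im = - z.im * ‖(φ : E)‖ ^ 2 := by
    have h0 : inner ℂ (φ : E) (φ : E) = ((‖(φ : E)‖ ^ 2 : ℝ) : ℂ) := by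
      rw [inner_self_eq_norm_sq_to_K]
      norm_cast
    rw [inner_sub_right, inner_smul_right, h0, Complex.sub_im, h1, Complex.im_mul_ofReal]
    ring
  have h3 : |z.im| * ‖(φ : E)‖ ^ 2 ≤ ‖(φ : E)‖ * ‖A φ - z • (φ : E)‖ := by
    calc |z.im| * ‖(φ : E)‖ ^ 2 = |(inner ℂ (φ : E) (A φ - z • (φ : E))).im| := by
          rw [h2, abs_mul, abs_neg, abs_of_nonneg (sq_nonneg ‖(φ : E)‖)]
      _ ≤ ‖inner ℂ (φ : E) (A φ - z • (φ : E))‖ := Complex.abs_im_le_norm _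
      _ ≤ _ := norm_inner_le_norm _ _
  rcases (norm_nonneg (φ : E)).eq_or_lt with h | h
  · rw [← h]; simp
  · nlinarith

/-- `(A - z)⁻¹` as a bounded operator; the zero operator if `A - z` has no bounded right inverse. -/
noncomputable def resolventOp (A : E →ₗ.[ℂ] E) (z : ℂ) : E →L[ℂ] E :=
  open Classical in
  if h : ∃ L : E →L[ℂ] E, ∀ ψ, ∃ φ : A.domain, (φ : E) = L ψ ∧ A φ - z • (φ : E) = ψ
  then h.choose else 0

namespace IsSelfAdjointOp

variable {A : E →ₗ.[ℂ] E} (hA : IsSelfAdjointOp A) {z w : ℂ}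
include hA

lemma eq_of_sub_smul_eq (hz : z.im ≠ 0) {φ χ : A.domain}
    (h : A φ - z • (φ : E) = A χ - z • (χ : E)) : φ = χ := by
  have h1 := abs_im_mul_norm_le_of_symm hA.symm z (φ - χ)
  have h2 : A (φ - χ) - z • ((φ - χ : A.domain) : E) = 0 := by
    rw [LinearPMap.map_sub, Submodule.coe_sub, smul_sub]
    rw [← sub_eq_zero] at h
    rw [← h]; abel
  rw [h2, norm_zero] at h1
  have h3 : 0 < |z.im| := abs_pos.2 hz
  have h4 : ‖((φ - χ : A.domain) : E)‖ = 0 := by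
    nlinarith [norm_nonneg ((φ - χ : A.domain) : E)]
  rw [norm_eq_zero, Submodule.coe_eq_zero, sub_eq_zero] at h4
  exact h4

lemma exists_resolvent (hz : z.im ≠ 0) :
    ∃ L : E →L[ℂ] E, ∀ ψ, ∃ φ : A.domain, (φ : E) = L ψ ∧ A φ - z • (φ : E) = ψ := by
  choose r hr using hA.surj z hz
  let L : E →ₗ[ℂ] E :=
    { toFun := fun ψ => (r ψ : E)
      map_add' := fun ψ χ => by
        rw [← Submodule.coe_add]
        congr 1
        apply hA.eq_of_sub_smul_eq hz
        rw [hr, LinearPMap.map_add, Submodule.coe_add, smul_add]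
        nth_rewrite 1 [← hr ψ, ← hr χ]
        abel
      map_smul' := fun c ψ => by
        rw [RingHom.id_apply, ← Submodule.coe_smul]
        congr 1
        apply hA.eq_of_sub_smul_eq hz
        rw [hr, LinearPMap.map_smul, Submodule.coe_smul, smul_comm z c, ← smul_sub, hr] }
  refine ⟨L.mkContinuous |z.im|⁻¹ fun ψ => ?_, fun ψ => ⟨r ψ, rfl, hr ψ⟩⟩
  have h1 := abs_im_mul_norm_le_of_symm hA.symm z (r ψ)
  rw [hr] at h1
  rwa [inv_mul_eq_div, le_div_iff₀' (abs_pos.2 hz)]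

lemma exists_eq_resolventOp (hz : z.im ≠ 0) (ψ : E) :
    ∃ φ : A.domain, (φ : E) = resolventOp A z ψ ∧ A φ - z • (φ : E) = ψ := by
  unfold resolventOp
  rw [dif_pos (hA.exists_resolvent hz)]
  exact (hA.exists_resolvent hz).choose_spec ψ

lemma eq_resolventOp (hz : z.im ≠ 0) (φ : A.domain) :
    resolventOp A z (A φ - z • (φ : E)) = φ := by
  obtain ⟨χ, h1, h2⟩ := hA.exists_eq_resolventOp hz (A φ - z • (φ : E))
  rw [← h1, hA.eq_of_sub_smul_eq hz h2]

lemma norm_resolventOp_le (hz : z.im ≠ 0) : ‖resolventOp A z‖ ≤ |z.im|⁻¹ := by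
  refine ContinuousLinearMap.opNorm_le_bound _ (by positivity) fun ψ => ?_
  obtain ⟨χ, h1, h2⟩ := hA.exists_eq_resolventOp hz ψ
  have h3 := abs_im_mul_norm_le_of_symm hA.symm z χ
  rw [h2, h1] at h3
  rwa [inv_mul_eq_div, le_div_iff₀' (abs_pos.2 hz)]

lemma resolventOp_injective (hz : z.im ≠ 0) {ψ : E} (h : resolventOp A z ψ = 0) : ψ = 0 := by
  obtain ⟨χ, h1, h2⟩ := hA.exists_eq_resolventOp hz ψ
  rw [h, Submodule.coe_eq_zero] at h1
  rw [← h2, h1]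
  simp

/-- The first resolvent identity. -/
lemma resolventOp_sub (hz : z.im ≠ 0) (hw : w.im ≠ 0) :
    resolventOp A z - resolventOp A w = (z - w) • (resolventOp A z * resolventOp A w) := by
  ext ψ
  obtain ⟨χ, h1, h2⟩ := hA.exists_eq_resolventOp hw ψ
  have h3 := hA.eq_resolventOp hz χ
  have h4 : A χ - z • (χ : E) = ψ - (z - w) • (χ : E) := by
    rw [← h2, sub_smul]; abel
  rw [h4, map_sub, map_smul, h1] at h3
  simp only [sub_apply, smul_apply, mul_apply_eq_comp]
  rw [sub_eq_iff_eq_add] at h3 ⊢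
  exact h3.trans (add_comm _ _)

lemma commute_resolventOp (hz : z.im ≠ 0) (hw : w.im ≠ 0) :
    resolventOp A z * resolventOp A w = resolventOp A w * resolventOp A z := by
  rcases eq_or_ne z w with rfl | h
  · rfl
  have h1 := hA.resolventOp_sub hz hw
  have h2 := hA.resolventOp_sub hw hz
  rw [← neg_sub, h2, ← neg_smul, neg_sub] at h1
  exact (smul_right_injective _ (sub_ne_zero.2 h) h1).symm

lemma inner_resolventOp_left (hz : z.im ≠ 0) (φ ψ : E) :
    inner ℂ (resolventOp A z φ) ψ = inner ℂ φ (resolventOp A (star z) ψ) := by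
  have hz' : (star z).im ≠ 0 := by simpa using hz
  obtain ⟨a, h1, h2⟩ := hA.exists_eq_resolventOp hz φ
  obtain ⟨b, h3, h4⟩ := hA.exists_eq_resolventOp hz' ψ
  rw [← h1, ← h3, ← h2]
  nth_rewrite 1 [← h4]
  rw [inner_sub_left, inner_sub_right, inner_smul_left, inner_smul_right, hA.symm]
  rfl

lemma star_resolventOp [CompleteSpace E] (hz : z.im ≠ 0) :
    star (resolventOp A z) = resolventOp A (star z) := by
  rw [ContinuousLinearMap.star_eq_adjoint]
  refine (ContinuousLinearMap.eq_adjoint_iff _ _).2 (fun x y => ?_) |>.symm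
  have hz' : (star z).im ≠ 0 := by simpa using hz
  rw [hA.inner_resolventOp_left hz', star_star]

/-- A spectral measure is a finite measure whose Stieltjes transform is `⟪ψ, (A - z)⁻¹ ψ⟫`. -/
lemma isSpectralMeasure_iff {ψ : E} {μ : Measure ℝ} :
    IsSpectralMeasure A ψ μ ↔ IsFiniteMeasure μ ∧ ∀ z : ℂ, z.im ≠ 0 →
      inner ℂ ψ (resolventOp A z ψ) = ∫ t : ℝ, ((t : ℂ) - z)⁻¹ ∂μ := by
  refine and_congr_right fun _ => forall₂_congr fun z hz => ⟨?_, fun h => ?_⟩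
  · rintro ⟨φ, h1, h2⟩
    have := hA.eq_resolventOp hz φ
    rw [h1] at this
    rw [this, h2]
  · obtain ⟨φ, h1, h2⟩ := hA.exists_eq_resolventOp hz ψ
    exact ⟨φ, h2, by rw [h1, h]⟩

end IsSelfAdjointOp

end Resolvent

/-! ### Stieltjes transforms and Poisson integrals -/

section Stieltjes

open Filter Topology

lemma ofReal_sub_ne_zero {z : ℂ} (hz : z.im ≠ 0) (t : ℝ) : (t : ℂ) - z ≠ 0 := fun h => by
  have := congrArg Complex.im h
  simp at this
  exact hz this

lemma norm_inv_ofReal_sub_le {z : ℂ} (hz : z.im ≠ 0) (t : ℝ) :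
    ‖((t : ℂ) - z)⁻¹‖ ≤ |z.im|⁻¹ := by
  rw [norm_inv]
  gcongr
  have := Complex.abs_im_le_norm ((t : ℂ) - z)
  simpa using this

lemma continuous_inv_ofReal_sub {z : ℂ} (hz : z.im ≠ 0) :
    Continuous fun t : ℝ => ((t : ℂ) - z)⁻¹ :=
  Continuous.inv₀ (by fun_prop) (ofReal_sub_ne_zero hz)

lemma integrable_inv_ofReal_sub (μ : Measure ℝ) [IsFiniteMeasure μ] {z : ℂ} (hz : z.im ≠ 0) :
    Integrable (fun t : ℝ => ((t : ℂ) - z)⁻¹) μ :=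
  (integrable_const (|z.im|⁻¹ : ℝ)).mono' (continuous_inv_ofReal_sub hz).aestronglyMeasurable
    (.of_forall (norm_inv_ofReal_sub_le hz))

lemma im_inv_ofReal_sub (t E y : ℝ) :
    (((t : ℂ) - (E + y * Complex.I))⁻¹).im = y / ((t - E) ^ 2 + y ^ 2) := by
  rw [Complex.inv_im, Complex.normSq_apply]
  simp
  ring_nf

lemma integrable_poisson (μ : Measure ℝ) [IsFiniteMeasure μ] (E : ℝ) {y : ℝ} (hy : 0 < y) :
    Integrable (fun t => y / ((t - E) ^ 2 + y ^ 2)) μ := by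
  have hk : ∀ t : ℝ, 0 < (t - E) ^ 2 + y ^ 2 := fun t => by positivity
  refine (integrable_const (1 / y)).mono' (Continuous.aestronglyMeasurable ?_)
    (.of_forall fun t => ?_)
  · exact Continuous.div (by fun_prop) (by fun_prop) fun t => (hk t).ne'
  · rw [Real.norm_of_nonneg (div_nonneg hy.le (hk t).le), div_le_div_iff₀ (hk t) hy]
    nlinarith [sq_nonneg (t - E)]

/-- The imaginary part of the Stieltjes transform is the Poisson integral (up to the factor `π`). -/
lemma im_integral_inv_ofReal_sub (μ : Measure ℝ) [IsFiniteMeasure μ] (E : ℝ) {y : ℝ} (hy : y ≠ 0) :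
    (∫ t : ℝ, ((t : ℂ) - (E + y * Complex.I))⁻¹ ∂μ).im = ∫ t, y / ((t - E) ^ 2 + y ^ 2) ∂μ := by
  have h := integral_im (𝕜 := ℂ) (integrable_inv_ofReal_sub μ (z := E + y * Complex.I) (by simpa))
  simp only [RCLike.im_to_complex] at h
  rw [← h]
  simp_rw [im_inv_ofReal_sub]

/-- The Poisson integral of a bounded continuous function, written as an average over dilations of
the Cauchy distribution. -/
lemma integral_comp_add_mul_cauchy (f : ℝ → ℝ) (t : ℝ) {y : ℝ} (hy : 0 < y) :
    ∫ s, f (t + y * s) * (1 + s ^ 2)⁻¹ = ∫ E, f E * (y / ((t - E) ^ 2 + y ^ 2)) := by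
  have h1 := integral_add_left_eq_self (μ := volume)
    (fun E => f E * (y / ((t - E) ^ 2 + y ^ 2))) t
  rw [← h1]
  have h2 := Measure.integral_comp_mul_left
    (fun E => f (t + E) * (y / ((t - (t + E)) ^ 2 + y ^ 2))) y
  rw [smul_eq_mul, abs_of_pos (inv_pos.2 hy), eq_inv_mul_iff_mul_eq₀ hy.ne'] at h2
  rw [← h2, ← integral_const_mul]
  congr 1
  funext s
  have : (t - (t + y * s)) ^ 2 + y ^ 2 = y ^ 2 * (1 + s ^ 2) := by ring
  rw [this]
  have : (1 + s ^ 2) ≠ 0 := by positivity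
  field_simp

/-- The Poisson integrals of a bounded continuous function converge to `π` times the function, and
the convergence may be integrated against a finite measure. -/
lemma tendsto_integral_poisson (μ : Measure ℝ) [IsFiniteMeasure μ]
    (f : BoundedContinuousFunction ℝ ℝ) :
    Tendsto (fun n : ℕ => ∫ t, (∫ s, f (t + (1 / ((n : ℝ) + 1)) * s) * (1 + s ^ 2)⁻¹) ∂μ) atTop
      (𝓝 (∫ t, f t * Real.pi ∂μ)) := by
  have hb : ∀ x s : ℝ, ‖f x * (1 + s ^ 2)⁻¹‖ ≤ ‖f‖ * (1 + s ^ 2)⁻¹ := fun x s => by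
    rw [norm_mul, Real.norm_of_nonneg (by positivity : (0 : ℝ) ≤ (1 + s ^ 2)⁻¹)]
    gcongr
    exact f.norm_coe_le_norm x
  have hi : Integrable (fun s : ℝ => ‖f‖ * (1 + s ^ 2)⁻¹) :=
    integrable_inv_one_add_sq.const_mul _
  have hc : ∀ y : ℝ, Continuous fun p : ℝ × ℝ => f (p.1 + y * p.2) * (1 + p.2 ^ 2)⁻¹ := fun y =>
    (f.continuous.comp (by fun_prop)).mul
      (Continuous.inv₀ (by fun_prop) fun p => by positivity)
  refine tendsto_integral_of_dominated_convergence (fun _ => ‖f‖ * Real.pi) (fun n => ?_)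
    (integrable_const (μ := μ) _) (fun n => .of_forall fun t => ?_) (.of_forall fun t => ?_)
  · exact ((hc _).stronglyMeasurable.integral_prod_right').aestronglyMeasurable
  · refine (norm_integral_le_of_norm_le hi (.of_forall fun s => hb _ s)).trans ?_
    rw [integral_const_mul, integral_univ_inv_one_add_sq]
  · rw [← integral_univ_inv_one_add_sq, ← integral_const_mul]
    refine tendsto_integral_of_dominated_convergence _ (fun n => ?_) hi
      (fun n => .of_forall fun s => hb _ s) (.of_forall fun s => ?_)
    · exact ((hc _).comp (Continuous.prodMk_right t)).aestronglyMeasurable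
    · refine Tendsto.mul_const _ ((f.continuous.tendsto t).comp ?_)
      have := (tendsto_one_div_add_atTop_nhds_zero_nat (𝕜 := ℝ)).mul_const s |>.const_add t
      simpa using this

/-- Poisson smoothing of a function against `μ` is the function against Poisson smoothing of `μ`. -/
lemma integral_poisson_swap (μ : Measure ℝ) [IsFiniteMeasure μ] (f : BoundedContinuousFunction ℝ ℝ)
    {y : ℝ} (hy : 0 < y) :
    ∫ t, (∫ s, f (t + y * s) * (1 + s ^ 2)⁻¹) ∂μ =
      ∫ E, f E * ∫ t, y / ((t - E) ^ 2 + y ^ 2) ∂μ := by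
  rw [integral_congr_ae (.of_forall fun t => integral_comp_add_mul_cauchy f t hy)]
  have hk : ∀ t E : ℝ, 0 < (t - E) ^ 2 + y ^ 2 := fun t E => by positivity
  have hc : Continuous fun p : ℝ × ℝ => f p.2 * (y / ((p.1 - p.2) ^ 2 + y ^ 2)) :=
    (f.continuous.comp continuous_snd).mul
      (Continuous.div (by fun_prop) (by fun_prop) fun p => (hk _ _).ne')
  have hI : ∀ t : ℝ, Integrable fun E => y / ((t - E) ^ 2 + y ^ 2) := fun t => by
    have h1 := ((integrable_inv_one_add_sq.comp_mul_left' (inv_ne_zero hy.ne')).comp_sub_left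
      t).const_mul y⁻¹
    refine h1.congr (.of_forall fun E => ?_)
    have := (hk t E).ne'
    have h3 : 1 + (y⁻¹ * (t - E)) ^ 2 = ((t - E) ^ 2 + y ^ 2) / y ^ 2 := by field_simp; ring
    simp only
    rw [h3]
    field_simp
  have hv : ∀ t : ℝ, ∫ E, y / ((t - E) ^ 2 + y ^ 2) = Real.pi := fun t => by
    have := integral_comp_add_mul_cauchy (fun _ => 1) t hy
    simp only [one_mul] at this
    rw [← this, integral_univ_inv_one_add_sq]
  have hb : ∀ t E : ℝ, ‖f E * (y / ((t - E) ^ 2 + y ^ 2))‖ ≤ ‖f‖ * (y / ((t - E) ^ 2 + y ^ 2)) :=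
    fun t E => by
      have : 0 ≤ y / ((t - E) ^ 2 + y ^ 2) := by have := hk t E; positivity
      rw [norm_mul, Real.norm_of_nonneg this]
      gcongr
      exact f.norm_coe_le_norm E
  have hint : Integrable (fun p : ℝ × ℝ => f p.2 * (y / ((p.1 - p.2) ^ 2 + y ^ 2)))
      (μ.prod volume) := by
    refine (integrable_prod_iff hc.aestronglyMeasurable).2 ⟨.of_forall fun t => ?_, ?_⟩
    · exact ((hI t).const_mul ‖f‖).mono'
        (hc.comp (Continuous.prodMk_right t)).aestronglyMeasurable (.of_forall (hb t))
    · refine (integrable_const (‖f‖ * Real.pi)).mono'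
        (hc.norm.stronglyMeasurable.integral_prod_right').aestronglyMeasurable
        (.of_forall fun t => ?_)
      refine (norm_integral_le_of_norm_le ((hI t).const_mul ‖f‖)
        (.of_forall fun E => ?_)).trans ?_
      · rw [norm_norm]; exact hb t E
      · rw [integral_const_mul, hv]
  rw [integral_integral_swap hint]
  simp_rw [integral_const_mul]

/-- A finite measure on the line is determined by its Stieltjes transform: the imaginary parts are
the Poisson integrals of the measure, which converge weakly to it. -/
theorem measure_eq_of_stieltjes_eq {μ ν : Measure ℝ} [IsFiniteMeasure μ] [IsFiniteMeasure ν]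
    (h : ∀ z : ℂ, z.im ≠ 0 → ∫ t : ℝ, ((t : ℂ) - z)⁻¹ ∂μ = ∫ t : ℝ, ((t : ℂ) - z)⁻¹ ∂ν) :
    μ = ν := by
  refine ext_of_forall_integral_eq_of_IsFiniteMeasure fun f => ?_
  have h1 := tendsto_integral_poisson μ f
  have h2 := tendsto_integral_poisson ν f
  have h3 : ∀ n : ℕ, ∫ t, (∫ s, f (t + (1 / ((n : ℝ) + 1)) * s) * (1 + s ^ 2)⁻¹) ∂μ =
      ∫ t, (∫ s, f (t + (1 / ((n : ℝ) + 1)) * s) * (1 + s ^ 2)⁻¹) ∂ν := fun n => by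
    have hy : (0 : ℝ) < 1 / ((n : ℝ) + 1) := by positivity
    rw [integral_poisson_swap μ f hy, integral_poisson_swap ν f hy]
    congr 1
    funext E
    rw [← im_integral_inv_ofReal_sub μ E hy.ne', ← im_integral_inv_ofReal_sub ν E hy.ne',
      h _ (by
        rw [Complex.add_im, Complex.ofReal_im, Complex.im_ofReal_mul, Complex.I_im, zero_add,
          mul_one]
        exact hy.ne')]
  simp_rw [h3] at h1
  have h4 := tendsto_nhds_unique h1 h2
  rw [integral_mul_const, integral_mul_const] at h4
  exact mul_right_cancel₀ Real.pi_ne_zero h4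

end Stieltjes

/-! ### Spectral measures of bounded normal operators -/

section Normal

open Filter Topology

variable {E : Type*} [NormedAddCommGroup E] [InnerProductSpace ℂ E] [CompleteSpace E]

/-- The continuous functional calculus of a bounded normal operator. -/
noncomputable abbrev normalCalculus (a : E →L[ℂ] E) (ha : IsStarNormal a) :
    C(spectrum ℂ a, ℂ) →⋆ₐ[ℂ] (E →L[ℂ] E) := cfcHom ha

variable {a : E →L[ℂ] E} (ha : IsStarNormal a)

lemma inner_normalCalculus_left (g : C(spectrum ℂ a, ℂ)) (φ ψ : E) :
    inner ℂ (normalCalculus a ha g φ) ψ = inner ℂ φ (normalCalculus a ha (star g) ψ) := by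
  rw [map_star, ContinuousLinearMap.star_eq_adjoint, ContinuousLinearMap.adjoint_inner_right]

lemma normalCalculus_mul_apply (g h : C(spectrum ℂ a, ℂ)) (ψ : E) :
    normalCalculus a ha (g * h) ψ = normalCalculus a ha g (normalCalculus a ha h ψ) := by
  rw [map_mul]; rfl

/-- The inclusion of the real-valued continuous functions into the complex-valued ones. -/
noncomputable def complexify {X : Type*} [TopologicalSpace X] (f : C(X, ℝ)) : C(X, ℂ) :=
  ⟨fun x => (f x : ℂ), by fun_prop⟩

lemma star_complexify {X : Type*} [TopologicalSpace X] (f : C(X, ℝ)) :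
    star (complexify f) = complexify f := by
  ext x; simp [complexify]

lemma re_inner_normalCalculus_nonneg (f : C(spectrum ℂ a, ℝ)) (hf : ∀ x, 0 ≤ f x) (ψ : E) :
    0 ≤ (inner ℂ ψ (normalCalculus a ha (complexify f) ψ)).re := by
  let g : C(spectrum ℂ a, ℝ) := ⟨fun x => √(f x), by fun_prop⟩
  have h1 : complexify f = star (complexify g) * complexify g := by
    ext x
    rw [star_complexify]
    simp only [complexify, ContinuousMap.mul_apply, ContinuousMap.coe_mk, g]
    rw [← Complex.ofReal_mul, Real.mul_self_sqrt (hf x)]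
  rw [h1, normalCalculus_mul_apply, ← inner_normalCalculus_left]
  exact inner_self_nonneg (𝕜 := ℂ)

/-- Riesz–Markov–Kakutani turns the continuous functional calculus into spectral measures on the
spectrum of a normal operator. -/
theorem exists_measure_normalCalculus (ψ : E) :
    ∃ ρ : Measure (spectrum ℂ a), IsFiniteMeasure ρ ∧
      ∀ g : C(spectrum ℂ a, ℂ), inner ℂ ψ (normalCalculus a ha g ψ) = ∫ x, g x ∂ρ := by
  have hadd : ∀ f g : C(spectrum ℂ a, ℝ), complexify (f + g) = complexify f + complexify g :=
    fun f g => by ext x; simp [complexify]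
  have hsmul : ∀ (c : ℝ) (f : C(spectrum ℂ a, ℝ)), complexify (c • f) = (c : ℂ) • complexify f :=
    fun c f => by ext x; simp [complexify]
  let Λ : CompactlySupportedContinuousMap (spectrum ℂ a) ℝ →ₚ[ℝ] ℝ := PositiveLinearMap.mk₀
    { toFun := fun f => (inner ℂ ψ (normalCalculus a ha (complexify f.toContinuousMap) ψ)).re
      map_add' := fun f g => by
        have : (f + g).toContinuousMap = f.toContinuousMap + g.toContinuousMap := rfl
        rw [this, hadd, map_add, add_apply, inner_add_right, Complex.add_re]
      map_smul' := fun c f => by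
        have : (c • f).toContinuousMap = c • f.toContinuousMap := rfl
        rw [this, hsmul, map_smul, smul_apply, inner_smul_right, Complex.re_ofReal_mul]
        rfl }
    (fun f hf => re_inner_normalCalculus_nonneg ha _ (fun x => hf x) ψ)
  refine ⟨RealRMK.rieszMeasure Λ, inferInstance, fun g => ?_⟩
  have hreal : ∀ f : C(spectrum ℂ a, ℝ), inner ℂ ψ (normalCalculus a ha (complexify f) ψ) =
      ((∫ x, f x ∂(RealRMK.rieszMeasure Λ) : ℝ) : ℂ) := fun f => by
    have h1 := RealRMK.integral_rieszMeasure Λ ⟨f, HasCompactSupport.of_compactSpace _⟩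
    have h2 : ∫ x, f x ∂(RealRMK.rieszMeasure Λ) =
      (inner ℂ ψ (normalCalculus a ha (complexify f) ψ)).re := h1
    rw [h2]
    symm
    rw [← Complex.conj_eq_iff_re, inner_conj_symm, inner_normalCalculus_left, star_complexify]
  let u : C(spectrum ℂ a, ℝ) := ⟨fun x => (g x).re, by fun_prop⟩
  let v : C(spectrum ℂ a, ℝ) := ⟨fun x => (g x).im, by fun_prop⟩
  have hg : g = complexify u + Complex.I • complexify v := by
    ext x
    simp only [complexify, u, v, ContinuousMap.add_apply, ContinuousMap.smul_apply,
      ContinuousMap.coe_mk, smul_eq_mul]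
    rw [mul_comm, Complex.re_add_im]
  have hgi : Integrable (fun x => g x) (RealRMK.rieszMeasure Λ) :=
    g.continuous.integrable_of_hasCompactSupport (HasCompactSupport.of_compactSpace _)
  have h3 := integral_re_add_im hgi
  nth_rewrite 1 [hg]
  rw [map_add, map_smul, add_apply, smul_apply, inner_add_right, inner_smul_right, hreal, hreal,
    ← h3, mul_comm]
  rfl

/-- A measure on the spectrum of the normal operator `a` representing the functional calculus at
the vector `ψ`. -/
def IsNormalSpectralMeasure (ψ : E) (ρ : Measure (spectrum ℂ a)) : Prop :=
  ∀ g : C(spectrum ℂ a, ℂ), inner ℂ ψ (normalCalculus a ha g ψ) = ∫ x, g x ∂ρ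

variable {ha} {ψ : E} {ρ : Measure (spectrum ℂ a)} [IsFiniteMeasure ρ]

/-- `g ↦ g(a) ψ` is isometric for the norm of `L²` of the spectral measure of `ψ`. -/
lemma IsNormalSpectralMeasure.norm_apply (h : IsNormalSpectralMeasure ha ψ ρ)
    (g : C(spectrum ℂ a, ℂ)) :
    ‖normalCalculus a ha g ψ‖ = ‖ContinuousMap.toLp 2 ρ ℂ g‖ := by
  have h1 : inner ℂ (normalCalculus a ha g ψ) (normalCalculus a ha g ψ) =
      inner ℂ (ContinuousMap.toLp 2 ρ ℂ g) (ContinuousMap.toLp 2 ρ ℂ g) := by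
    rw [inner_normalCalculus_left, ← normalCalculus_mul_apply, h, L2.inner_def]
    refine integral_congr_ae ?_
    filter_upwards [ContinuousMap.coeFn_toLp (𝕜 := ℂ) (p := 2) ρ g] with x hx
    rw [hx]
    simp [mul_comm, Complex.mul_conj']
  rw [inner_self_eq_norm_sq_to_K, inner_self_eq_norm_sq_to_K] at h1
  norm_cast at h1
  rwa [sq_eq_sq₀ (norm_nonneg _) (norm_nonneg _)] at h1

/-- The cyclic representation: `L²` of the spectral measure embeds isometrically, intertwining
multiplication with the functional calculus. The image of the indicator function of `S` is therefore
a vector whose spectral measure is the restriction to `S`. -/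
theorem IsNormalSpectralMeasure.exists_restrict (h : IsNormalSpectralMeasure ha ψ ρ)
    {S : Set (spectrum ℂ a)} (hS : MeasurableSet S) :
    ∃ χ : E, IsNormalSpectralMeasure ha χ (ρ.restrict S) := by
  let f : C(spectrum ℂ a, ℂ) →ₗ[ℂ] E :=
    { toFun := fun g => normalCalculus a ha g ψ
      map_add' := fun g k => by rw [map_add]; rfl
      map_smul' := fun c g => by rw [map_smul]; rfl }
  let e : C(spectrum ℂ a, ℂ) →ₗ[ℂ] Lp ℂ 2 ρ := (ContinuousMap.toLp 2 ρ ℂ).toLinearMap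
  have hd : DenseRange e := ContinuousMap.toLp_denseRange ℂ ρ ℂ (by norm_num)
  have hn : ∀ g, ‖f g‖ ≤ 1 * ‖e g‖ := fun g => by rw [one_mul]; exact (h.norm_apply g).le
  let W : Lp ℂ 2 ρ →L[ℂ] E := f.extendOfNorm e
  have hW : ∀ g, W (ContinuousMap.toLp 2 ρ ℂ g) = normalCalculus a ha g ψ := fun g =>
    LinearMap.extendOfNorm_eq hd ⟨1, hn⟩ g
  have hWn : ∀ k, ‖W k‖ = ‖k‖ := fun k => by
    refine hd.induction_on (p := fun k => ‖W k‖ = ‖k‖) k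
      (isClosed_eq (by fun_prop) (by fun_prop)) fun g => ?_
    change ‖W (ContinuousMap.toLp 2 ρ ℂ g)‖ = ‖ContinuousMap.toLp 2 ρ ℂ g‖
    rw [hW, h.norm_apply]
  have hWi : ∀ k l, inner ℂ (W k) (W l) = inner ℂ k l := fun k l =>
    LinearIsometry.inner_map_map ⟨W.toLinearMap, hWn⟩ k l
  let k₀ : Lp ℂ 2 ρ := indicatorConstLp 2 hS (measure_ne_top _ _) 1
  refine ⟨W k₀, fun g => ?_⟩
  -- multiplication by the bounded function `g` on `L²`
  let G : Lp ℂ ∞ ρ := ContinuousMap.toLp ∞ ρ ℂ g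
  let M : Lp ℂ 2 ρ →L[ℂ] Lp ℂ 2 ρ := (ContinuousLinearMap.mul ℂ ℂ).holderL ρ ∞ 2 2 G
  have hM : ∀ k, M k =ᵐ[ρ] fun x => g x * k x := fun k => by
    filter_upwards [(ContinuousLinearMap.mul ℂ ℂ).coeFn_holder (r := 2) G k,
      ContinuousMap.coeFn_toLp (𝕜 := ℂ) (p := ∞) ρ g] with x h1 h2
    rw [← h2]
    exact h1
  have hWM : ∀ k, W (M k) = normalCalculus a ha g (W k) := fun k => by
    refine hd.induction_on (p := fun k => W (M k) = normalCalculus a ha g (W k)) k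
      (isClosed_eq (by fun_prop) (by fun_prop)) fun l => ?_
    change W (M (ContinuousMap.toLp 2 ρ ℂ l)) =
      normalCalculus a ha g (W (ContinuousMap.toLp 2 ρ ℂ l))
    have : M (ContinuousMap.toLp 2 ρ ℂ l) = ContinuousMap.toLp 2 ρ ℂ (g * l) := by
      refine Lp.ext ?_
      filter_upwards [hM (ContinuousMap.toLp 2 ρ ℂ l),
        ContinuousMap.coeFn_toLp (𝕜 := ℂ) (p := 2) ρ l,
        ContinuousMap.coeFn_toLp (𝕜 := ℂ) (p := 2) ρ (g * l)] with x h1 h2 h3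
      rw [h1, h2, h3]
      rfl
    rw [this, hW, hW, normalCalculus_mul_apply]
  rw [← hWM, hWi, L2.inner_def, ← integral_indicator hS]
  refine integral_congr_ae ?_
  have h1 : k₀ =ᵐ[ρ] S.indicator fun _ => (1 : ℂ) := indicatorConstLp_coeFn
  filter_upwards [hM k₀, h1] with x h2 h3
  rw [h2, h3]
  by_cases hx : x ∈ S <;> simp [hx]

end Normal

/-! ### Spectral measures of unbounded self-adjoint operators -/

section SpectralTheorem

open Filter Topology

variable {E : Type*} [NormedAddCommGroup E] [InnerProductSpace ℂ E] [CompleteSpace E]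
  {A : E →ₗ.[ℂ] E}

namespace IsSelfAdjointOp

variable (hA : IsSelfAdjointOp A)
include hA

lemma isStarNormal_resolventOp {z : ℂ} (hz : z.im ≠ 0) : IsStarNormal (resolventOp A z) :=
  ⟨by rw [hA.star_resolventOp hz]; exact hA.commute_resolventOp (by simpa using hz) hz⟩

lemma isStarNormal_resolventOp_I : IsStarNormal (resolventOp A Complex.I) :=
  hA.isStarNormal_resolventOp (by simp)

omit hA in
/-- The point of the real line corresponding to the point `(t - i)⁻¹` of the spectrum of
`(A - i)⁻¹`; junk at `0`, which corresponds to infinity. -/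
noncomputable def spectralParam (A : E →ₗ.[ℂ] E) (w : spectrum ℂ (resolventOp A Complex.I)) : ℝ :=
  ((w : ℂ)⁻¹).re

omit hA [CompleteSpace E] in
lemma measurable_spectralParam : Measurable (spectralParam A) := by
  unfold spectralParam
  fun_prop

/-- The spectrum of `(A - i)⁻¹` lies on the image of the real line under `t ↦ (t - i)⁻¹`,
together with `0`: by the resolvent identity `w - w̄ = 2 i w w̄` on it. -/
lemma inv_eq_spectralParam_sub (w : spectrum ℂ (resolventOp A Complex.I)) (hw : (w : ℂ) ≠ 0) :
    (w : ℂ)⁻¹ = spectralParam A w - Complex.I := by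
  have ha := hA.isStarNormal_resolventOp_I
  let k : C(spectrum ℂ (resolventOp A Complex.I), ℂ) := (ContinuousMap.id ℂ).restrict _
  have h1 : cfcHom ha k = resolventOp A Complex.I := cfcHom_id ha
  have h2 : k - star k = (2 * Complex.I) • (k * star k) := by
    refine cfcHom_injective ha ?_
    have h3 := hA.resolventOp_sub (z := Complex.I) (w := star Complex.I) (by simp) (by simp)
    rw [map_sub, map_smul, map_mul, map_star, h1, hA.star_resolventOp (by simp), h3]
    congr 1
    simp
    ring
  have h4 : (w : ℂ) - star (w : ℂ) = 2 * Complex.I * ((w : ℂ) * star (w : ℂ)) :=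
    congrArg (fun f : C(spectrum ℂ (resolventOp A Complex.I), ℂ) => f w) h2
  have h5 : (w : ℂ)⁻¹ - star (w : ℂ)⁻¹ = -(2 * Complex.I) := by
    have hs : star (w : ℂ) ≠ 0 := star_ne_zero.2 hw
    rw [star_inv₀]
    field_simp
    linear_combination -h4
  have h6 := congrArg Complex.im h5
  have h7 : ((w : ℂ)⁻¹).im = -1 := by
    simp only [Complex.sub_im, Complex.star_def, Complex.conj_im, Complex.neg_im, Complex.mul_im,
      Complex.I_im, Complex.I_re, Complex.re_ofNat, Complex.im_ofNat] at h6
    linarith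
  apply Complex.ext <;> simp [spectralParam, h7]

lemma one_add_mul_ne_zero {z : ℂ} (hz : z.im ≠ 0) (w : spectrum ℂ (resolventOp A Complex.I)) :
    1 + (Complex.I - z) * (w : ℂ) ≠ 0 := by
  by_cases hw : (w : ℂ) = 0
  · simp [hw]
  · have h1 := hA.inv_eq_spectralParam_sub w hw
    have h2 : 1 + (Complex.I - z) * (w : ℂ) = w * (spectralParam A w - z) := by
      have : (spectralParam A w : ℂ) = (w : ℂ)⁻¹ + Complex.I := by rw [h1]; ring
      rw [this]
      field_simp
      ring
    rw [h2]
    exact mul_ne_zero hw (ofReal_sub_ne_zero hz _)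

/-- The function on the spectrum of `(A - i)⁻¹` whose functional calculus is `(A - z)⁻¹`. -/
noncomputable def resolventFun {z : ℂ} (hz : z.im ≠ 0) :
    C(spectrum ℂ (resolventOp A Complex.I), ℂ) :=
  ⟨fun w => (w : ℂ) * (1 + (Complex.I - z) * (w : ℂ))⁻¹, by
    refine continuous_subtype_val.mul (Continuous.inv₀ (by fun_prop) fun w => ?_)
    exact hA.one_add_mul_ne_zero hz w⟩

lemma resolventFun_apply {z : ℂ} (hz : z.im ≠ 0) (w : spectrum ℂ (resolventOp A Complex.I)) :
    hA.resolventFun hz w = if (w : ℂ) = 0 then 0 else ((spectralParam A w : ℂ) - z)⁻¹ := by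
  change (w : ℂ) * (1 + (Complex.I - z) * (w : ℂ))⁻¹ = _
  split_ifs with hw
  · simp [hw]
  · have h1 := hA.inv_eq_spectralParam_sub w hw
    have h2 : 1 + (Complex.I - z) * (w : ℂ) = w * (spectralParam A w - z) := by
      have : (spectralParam A w : ℂ) = (w : ℂ)⁻¹ + Complex.I := by rw [h1]; ring
      rw [this]
      field_simp
      ring
    rw [h2, mul_inv, mul_inv_cancel_left₀ hw]

lemma normalCalculus_resolventFun {z : ℂ} (hz : z.im ≠ 0) :
    normalCalculus _ hA.isStarNormal_resolventOp_I (hA.resolventFun hz) = resolventOp A z := by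
  have ha := hA.isStarNormal_resolventOp_I
  let k : C(spectrum ℂ (resolventOp A Complex.I), ℂ) := (ContinuousMap.id ℂ).restrict _
  have h1 : normalCalculus _ ha k = resolventOp A Complex.I := cfcHom_id ha
  let u : C(spectrum ℂ (resolventOp A Complex.I), ℂ) := 1 + (Complex.I - z) • k
  let v : C(spectrum ℂ (resolventOp A Complex.I), ℂ) :=
    ⟨fun w => (1 + (Complex.I - z) * (w : ℂ))⁻¹,
      Continuous.inv₀ (by fun_prop) fun w => hA.one_add_mul_ne_zero hz w⟩
  have huv : u * v = 1 := by
    ext w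
    exact mul_inv_cancel₀ (hA.one_add_mul_ne_zero hz w)
  have hkv : hA.resolventFun hz = k * v := by
    ext w
    rfl
  have hu : resolventOp A z * normalCalculus _ ha u = resolventOp A Complex.I := by
    have h2 := hA.resolventOp_sub (z := Complex.I) (w := z) (by simp) hz
    simp only [u]
    rw [map_add, map_one, map_smul, h1, mul_add, mul_one, mul_smul_comm,
      hA.commute_resolventOp hz (by simp), ← h2]
    abel
  calc normalCalculus _ ha (hA.resolventFun hz)
      = resolventOp A Complex.I * normalCalculus _ ha v := by rw [hkv, map_mul, h1]
    _ = resolventOp A z * normalCalculus _ ha u * normalCalculus _ ha v := by rw [hu]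
    _ = resolventOp A z := by rw [mul_assoc, ← map_mul, huv, map_one, mul_one]

/-- A measure on the spectrum of `(A - i)⁻¹` is moved to the real line, dropping a possible mass at the
point `0`, which stands for infinity; this does not affect the integrals of the functions representing
resolvents, as they vanish there. -/
lemma integral_map_spectralParam (ρ : Measure (spectrum ℂ (resolventOp A Complex.I))) {z : ℂ}
    (hz : z.im ≠ 0) :
    ∫ t : ℝ, ((t : ℂ) - z)⁻¹ ∂((ρ.restrict {w | (w : ℂ) ≠ 0}).map (spectralParam A)) =
      ∫ w, hA.resolventFun hz w ∂ρ := by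
  have hm : MeasurableSet {w : spectrum ℂ (resolventOp A Complex.I) | (w : ℂ) ≠ 0} :=
    (measurableSet_singleton (0 : ℂ)).compl.preimage measurable_subtype_coe
  rw [integral_map measurable_spectralParam.aemeasurable
    (continuous_inv_ofReal_sub hz).aestronglyMeasurable, ← integral_indicator hm]
  congr 1
  funext w
  rw [resolventFun_apply]
  by_cases hw : (w : ℂ) = 0 <;> simp [hw]

lemma isSpectralMeasure_map {ψ : E} {ρ : Measure (spectrum ℂ (resolventOp A Complex.I))}
    [IsFiniteMeasure ρ] (h : IsNormalSpectralMeasure hA.isStarNormal_resolventOp_I ψ ρ) :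
    IsSpectralMeasure A ψ ((ρ.restrict {w | (w : ℂ) ≠ 0}).map (spectralParam A)) := by
  rw [hA.isSpectralMeasure_iff]
  refine ⟨inferInstance, fun z hz => ?_⟩
  rw [hA.integral_map_spectralParam ρ hz, ← hA.normalCalculus_resolventFun hz]
  exact h _

theorem exists_isSpectralMeasure (ψ : E) : ∃ μ, IsSpectralMeasure A ψ μ := by
  obtain ⟨ρ, h1, h2⟩ := exists_measure_normalCalculus hA.isStarNormal_resolventOp_I ψ
  exact ⟨_, hA.isSpectralMeasure_map h2⟩

omit [CompleteSpace E] in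
lemma isSpectralMeasure_unique {ψ : E} {μ ν : Measure ℝ} (hμ : IsSpectralMeasure A ψ μ)
    (hν : IsSpectralMeasure A ψ ν) : μ = ν := by
  rw [hA.isSpectralMeasure_iff] at hμ hν
  have := hμ.1
  have := hν.1
  exact measure_eq_of_stieltjes_eq fun z hz => (hμ.2 z hz).symm.trans (hν.2 z hz)

/-- The restriction of a spectral measure to a Borel set `B` is again a spectral measure; the vector
is `1_B(A) ψ`. -/
theorem exists_isSpectralMeasure_restrict {ψ : E} {μ : Measure ℝ} (hμ : IsSpectralMeasure A ψ μ)
    {B : Set ℝ} (hB : MeasurableSet B) : ∃ χ, IsSpectralMeasure A χ (μ.restrict B) := by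
  obtain ⟨ρ, h1, h2⟩ := exists_measure_normalCalculus hA.isStarNormal_resolventOp_I ψ
  rw [hA.isSpectralMeasure_unique hμ (hA.isSpectralMeasure_map h2)]
  have hS := hB.preimage (measurable_spectralParam (A := A))
  obtain ⟨χ, hχ⟩ := IsNormalSpectralMeasure.exists_restrict h2 hS
  refine ⟨χ, ?_⟩
  have h3 := hA.isSpectralMeasure_map hχ
  have hm : MeasurableSet {w : spectrum ℂ (resolventOp A Complex.I) | (w : ℂ) ≠ 0} :=
    (measurableSet_singleton (0 : ℂ)).compl.preimage measurable_subtype_coe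
  rwa [Measure.restrict_comm hm, ← Measure.restrict_map measurable_spectralParam hB] at h3

omit [CompleteSpace E] in
lemma eq_zero_of_isSpectralMeasure_zero {ψ : E} (h : IsSpectralMeasure A ψ 0) : ψ = 0 := by
  rw [hA.isSpectralMeasure_iff] at h
  have h1 := h.2 Complex.I (by simp)
  rw [integral_zero_measure] at h1
  have h2 := h.2 (star Complex.I) (by simp)
  rw [integral_zero_measure] at h2
  have h3 := hA.resolventOp_sub (z := star Complex.I) (w := Complex.I) (by simp) (by simp)
  have h4 := congrArg (fun T : E →L[ℂ] E => inner ℂ ψ (T ψ)) h3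
  simp only [sub_apply, smul_apply, inner_sub_right, h1, h2, inner_smul_right,
    mul_apply_eq_comp] at h4
  rw [← hA.inner_resolventOp_left (by simp), sub_zero, eq_comm, mul_eq_zero, inner_self_eq_zero]
    at h4
  rcases h4 with h4 | h4
  · have := congrArg Complex.im h4
    norm_num at this
  · exact hA.resolventOp_injective (by simp) h4

omit [CompleteSpace E] in
lemma isSpectralMeasure_zero : IsSpectralMeasure A 0 0 := by
  rw [hA.isSpectralMeasure_iff]
  exact ⟨inferInstance, fun z _ => by simp⟩

/-- Vectors with mutually singular spectral measures generate orthogonal cyclic subspaces. With a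
continuous `g` close to the indicator function of a set carrying the first measure and null for the
second, one splits the resolvent function as `r = r g + r (1 - g)`; the first term is small at `χ`
and the second at `φ`. -/
theorem inner_resolventOp_eq_zero {φ χ : E} {μ ν : Measure ℝ} (hμ : IsSpectralMeasure A φ μ)
    (hν : IsSpectralMeasure A χ ν) (h : μ ⟂ₘ ν) {z : ℂ} (hz : z.im ≠ 0) :
    inner ℂ φ (resolventOp A z χ) = 0 := by
  have ha := hA.isStarNormal_resolventOp_I
  obtain ⟨ρ, h1, h2⟩ := exists_measure_normalCalculus ha φ
  obtain ⟨ρ', h1', h2'⟩ := exists_measure_normalCalculus ha χ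
  obtain ⟨B, hB, hμB, hνB⟩ := h
  rw [hA.isSpectralMeasure_unique hμ (hA.isSpectralMeasure_map h2)] at hμB
  rw [hA.isSpectralMeasure_unique hν (hA.isSpectralMeasure_map h2')] at hνB
  have hm : MeasurableSet {w : spectrum ℂ (resolventOp A Complex.I) | (w : ℂ) ≠ 0} :=
    (measurableSet_singleton (0 : ℂ)).compl.preimage measurable_subtype_coe
  have hB' := hB.preimage (measurable_spectralParam (A := A))
  rw [Measure.map_apply measurable_spectralParam hB, Measure.restrict_apply hB'] at hμB
  rw [Measure.map_apply measurable_spectralParam hB.compl, Measure.restrict_apply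
    (hB.compl.preimage measurable_spectralParam)] at hνB
  -- `S` carries all of `ρ` except for the point `0`, and none of `ρ'`
  let S : Set (spectrum ℂ (resolventOp A Complex.I)) := spectralParam A ⁻¹' Bᶜ ∩ {w | (w : ℂ) ≠ 0}
  have hS : MeasurableSet S := (hB.compl.preimage measurable_spectralParam).inter hm
  set r := hA.resolventFun hz with hr
  set T := normalCalculus _ ha with hT
  have key : ∀ ε : ℝ, 0 < ε → ‖inner ℂ φ (resolventOp A z χ)‖ ≤
      ε * (‖φ‖ * ‖T r‖ + ‖r‖ * ‖χ‖) := fun ε hε => by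
    have hmem : MemLp (S.indicator fun _ => (1 : ℂ)) 2 (ρ + ρ') :=
      memLp_indicator_const 2 hS 1 (Or.inr (measure_ne_top _ _))
    obtain ⟨g', hg', -⟩ := hmem.exists_boundedContinuous_eLpNorm_sub_le (by norm_num)
      (ε := ENNReal.ofReal ε) (by simpa using hε)
    let g : C(spectrum ℂ (resolventOp A Complex.I), ℂ) := g'.toContinuousMap
    have hg1 : ‖T g χ‖ ≤ ε := by
      rw [IsNormalSpectralMeasure.norm_apply h2', Lp.norm_def,
        eLpNorm_congr_ae (ContinuousMap.coeFn_toLp ρ' g)]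
      refine ENNReal.toReal_le_of_le_ofReal hε.le (le_trans ?_ hg')
      refine le_trans (le_of_eq ?_) (eLpNorm_mono_measure _ (Measure.le_add_left le_rfl))
      rw [← eLpNorm_neg]
      refine eLpNorm_congr_ae ?_
      filter_upwards [measure_eq_zero_iff_ae_notMem.1 hνB] with w hw
      have : w ∉ S := hw
      simp [this, g]
    have hg2 : ‖T (star (r * (1 - g))) φ‖ ≤ ‖r‖ * ε := by
      rw [IsNormalSpectralMeasure.norm_apply h2, Lp.norm_def,
        eLpNorm_congr_ae (ContinuousMap.coeFn_toLp ρ _)]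
      refine ENNReal.toReal_le_of_le_ofReal (by positivity) ?_
      have h3 : eLpNorm (⇑(star (r * (1 - g)))) 2 ρ ≤
          ENNReal.ofReal ‖r‖ * eLpNorm (S.indicator (fun _ => (1 : ℂ)) - ⇑g') 2 ρ := by
        refine eLpNorm_le_mul_eLpNorm_of_ae_le_mul ?_ 2
        filter_upwards [measure_eq_zero_iff_ae_notMem.1 hμB] with w hw
        simp only [ContinuousMap.star_apply, norm_star, ContinuousMap.mul_apply, norm_mul,
          Pi.sub_apply]
        by_cases hw0 : (w : ℂ) = 0
        · rw [hr, hA.resolventFun_apply hz, if_pos hw0, norm_zero, zero_mul]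
          positivity
        · have hwS : w ∈ S := ⟨fun hb => hw ⟨hb, hw0⟩, hw0⟩
          rw [Set.indicator_of_mem hwS]
          exact mul_le_mul_of_nonneg_right (r.norm_coe_le_norm w) (norm_nonneg _)
      refine h3.trans ?_
      rw [ENNReal.ofReal_mul (norm_nonneg _)]
      gcongr
      exact (eLpNorm_mono_measure _ (Measure.le_add_right le_rfl)).trans hg'
    have hsplit : inner ℂ φ (resolventOp A z χ) =
        inner ℂ φ (T r (T g χ)) + inner ℂ (T (star (r * (1 - g))) φ) χ := by
      rw [inner_normalCalculus_left, star_star, hT, ← normalCalculus_mul_apply, ← inner_add_right,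
        ← add_apply, ← map_add, ← hA.normalCalculus_resolventFun hz]
      congr 3
      ring
    rw [hsplit]
    calc _ ≤ ‖inner ℂ φ (T r (T g χ))‖ + ‖inner ℂ (T (star (r * (1 - g))) φ) χ‖ := norm_add_le _ _
      _ ≤ ‖φ‖ * (‖T r‖ * ε) + ‖r‖ * ε * ‖χ‖ := by
        refine add_le_add ((norm_inner_le_norm _ _).trans ?_) ((norm_inner_le_norm _ _).trans ?_)
        · gcongr
          exact ((T r).le_opNorm _).trans (by gcongr)
        · gcongr
      _ = _ := by ring
  rw [← norm_le_zero_iff]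
  have hlim : Tendsto (fun ε : ℝ => ε * (‖φ‖ * ‖T r‖ + ‖r‖ * ‖χ‖)) (𝓝[>] 0) (𝓝 0) := by
    have : Tendsto (fun ε : ℝ => ε * (‖φ‖ * ‖T r‖ + ‖r‖ * ‖χ‖)) (𝓝 0)
      (𝓝 (0 * (‖φ‖ * ‖T r‖ + ‖r‖ * ‖χ‖))) := tendsto_id.mul_const _
    rw [zero_mul] at this
    exact this.mono_left nhdsWithin_le_nhds
  exact ge_of_tendsto hlim (eventually_nhdsWithin_of_forall key)

/-- An orthogonal projection commuting with the resolvents does not increase spectral measures: the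
spectral measure of `ψ` is the sum of those of `P ψ` and `ψ - P ψ`. -/
theorem spectralMeasure_projection_le {P : E →L[ℂ] E} (hP : IsStarProjection P)
    (hcomm : ∀ z : ℂ, z.im ≠ 0 → P * resolventOp A z = resolventOp A z * P) {ψ : E}
    {μ ν : Measure ℝ} (hμ : IsSpectralMeasure A ψ μ) (hν : IsSpectralMeasure A (P ψ) ν) :
    ν ≤ μ := by
  obtain ⟨ν', hν'⟩ := hA.exists_isSpectralMeasure (ψ - P ψ)
  suffices h : IsSpectralMeasure A ψ (ν + ν') by
    rw [hA.isSpectralMeasure_unique hμ h]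
    exact Measure.le_add_right le_rfl
  rw [hA.isSpectralMeasure_iff] at hν hν' ⊢
  have := hν.1
  have := hν'.1
  refine ⟨inferInstance, fun z hz => ?_⟩
  rw [integral_add_measure (integrable_inv_ofReal_sub _ hz) (integrable_inv_ofReal_sub _ hz),
    ← hν.2 z hz, ← hν'.2 z hz]
  have h1 : ∀ x y : E, inner ℂ (P x) y = inner ℂ x (P y) := fun x y => by
    have := hP.isSelfAdjoint.star_eq
    rw [ContinuousLinearMap.star_eq_adjoint] at this
    rw [← ContinuousLinearMap.adjoint_inner_right, this]
  have h2 : ∀ x, resolventOp A z (P x) = P (resolventOp A z x) := fun x =>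
    congrArg (fun T : E →L[ℂ] E => T x) (hcomm z hz).symm
  have h3 : ∀ x, P (P x) = P x := fun x =>
    congrArg (fun T : E →L[ℂ] E => T x) hP.isIdempotentElem.eq
  rw [map_sub, h2, inner_sub_left, inner_sub_right, inner_sub_right]
  simp only [h1, h3]
  ring

end IsSelfAdjointOp

end SpectralTheorem

/-! ### Boundary values of Stieltjes transforms -/

section BoundaryValues

open Filter Topology Set

/-- If the measure of every interval centred at `E` is at most `η` times its radius, the Poisson
integral at `E` is at most `2 η`, by the layer-cake formula: the superlevel sets of the Poisson kernel
at height `s ≤ 1 / y` lie in the interval of radius `√(y / s)`. -/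
lemma poisson_le_of_measure_closedBall_le (μ : Measure ℝ) [IsFiniteMeasure μ] (E η : ℝ)
    (h : ∀ r > 0, μ.real (Metric.closedBall E r) ≤ η * r) {y : ℝ} (hy : 0 < y) :
    ∫ t, y / ((t - E) ^ 2 + y ^ 2) ∂μ ≤ 2 * η := by
  have hη : 0 ≤ η := by simpa using (measureReal_nonneg).trans (h 1 one_pos)
  have hk : ∀ t : ℝ, 0 < (t - E) ^ 2 + y ^ 2 := fun t => by positivity
  have hle : ∀ t : ℝ, y / ((t - E) ^ 2 + y ^ 2) ≤ 1 / y := fun t => by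
    rw [div_le_div_iff₀ (hk t) hy]
    nlinarith [sq_nonneg (t - E)]
  rw [(integrable_poisson μ E hy).integral_eq_integral_meas_lt
    (.of_forall fun t => div_nonneg hy.le (hk t).le)]
  have hIoc : IntegrableOn (fun s : ℝ => η * y ^ (1 / 2 : ℝ) * s ^ (-(1 / 2) : ℝ))
      (Ioc 0 (1 / y)) := by
    rw [← intervalIntegrable_iff_integrableOn_Ioc_of_le (by positivity)]
    exact (intervalIntegral.intervalIntegrable_rpow' (by norm_num)).const_mul _
  have hval : ∫ s in Ioc 0 (1 / y), η * y ^ (1 / 2 : ℝ) * s ^ (-(1 / 2) : ℝ) = 2 * η := by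
    rw [← intervalIntegral.integral_of_le (by positivity), intervalIntegral.integral_const_mul,
      integral_rpow (Or.inl (by norm_num)), Real.zero_rpow (by norm_num)]
    norm_num
    rw [Real.inv_rpow hy.le]
    have := (Real.rpow_pos_of_pos hy (1 / 2)).ne'
    field_simp
  rw [← hval, ← integral_indicator measurableSet_Ioc, ← integral_indicator measurableSet_Ioi]
  refine integral_mono_of_nonneg (.of_forall fun s => ?_) (hIoc.integrable_indicator
    measurableSet_Ioc) (.of_forall fun s => ?_)
  · exact indicator_nonneg (fun _ _ => measureReal_nonneg) _
  by_cases hs : s ∈ Ioi (0 : ℝ)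
  swap
  · rw [indicator_of_notMem hs]
    exact indicator_nonneg (fun s hs => mul_nonneg (mul_nonneg hη (by positivity))
      (Real.rpow_nonneg hs.1.le _)) _
  have hs0 : 0 < s := hs
  rw [indicator_of_mem hs]
  by_cases hs' : s ≤ 1 / y
  · rw [indicator_of_mem (show s ∈ Ioc 0 (1 / y) from ⟨hs, hs'⟩)]
    have hr : 0 < y ^ (1 / 2 : ℝ) * s ^ (-(1 / 2) : ℝ) := by positivity
    rw [mul_assoc]
    refine le_trans (measureReal_mono fun t ht => ?_) (h _ hr)
    rw [Metric.mem_closedBall, Real.dist_eq]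
    refine abs_le_of_sq_le_sq ?_ hr.le
    have h1 : (y ^ (1 / 2 : ℝ) * s ^ (-(1 / 2) : ℝ)) ^ 2 = y / s := by
      rw [mul_pow, ← Real.rpow_mul_natCast hy.le, ← Real.rpow_mul_natCast hs0.le]
      norm_num
      rw [Real.rpow_neg_one]
      rfl
    have h2 : s < y / ((t - E) ^ 2 + y ^ 2) := ht
    rw [h1, le_div_iff₀ hs0]
    rw [lt_div_iff₀ (hk t)] at h2
    nlinarith [sq_nonneg y]
  · have : {t | s < y / ((t - E) ^ 2 + y ^ 2)} = ∅ :=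
      eq_empty_of_forall_notMem fun t ht => hs' (ht.le.trans (hle t))
    rw [this, measureReal_empty]
    exact indicator_nonneg (fun s hs => mul_nonneg (mul_nonneg hη (by positivity))
      (Real.rpow_nonneg hs.1.le _)) _

/-- Where a measure has zero density, its Poisson integral has the vertical boundary value zero. -/
lemma tendsto_poisson_zero (μ : Measure ℝ) [IsFiniteMeasure μ] (E : ℝ)
    (h : Tendsto (fun r => μ (Metric.closedBall E r) / volume (Metric.closedBall E r)) (𝓝[>] 0)
      (𝓝 0)) :
    Tendsto (fun y : ℝ => ∫ t, y / ((t - E) ^ 2 + y ^ 2) ∂μ) (𝓝[>] 0) (𝓝 0) := by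
  have hk : ∀ t y : ℝ, 0 < y → 0 < (t - E) ^ 2 + y ^ 2 := fun t y hy => by positivity
  rw [Metric.tendsto_nhdsWithin_nhds]
  intro ε hε
  obtain ⟨r₀, hr₀, hr⟩ : ∃ r₀ > 0, ∀ r ∈ Ioc 0 r₀, μ.real (Metric.closedBall E r) ≤ ε / 8 * r := by
    have h1 := (tendsto_order.1 h).2 (ENNReal.ofReal (ε / 16)) (by simpa using hε)
    rw [eventually_nhdsWithin_iff, Metric.eventually_nhds_iff] at h1
    obtain ⟨δ, hδ, h1⟩ := h1
    refine ⟨δ / 2, by positivity, fun r hr => ?_⟩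
    have h2 := h1 (y := r) (by rw [Real.dist_eq, sub_zero, abs_of_pos hr.1]; linarith [hr.2]) hr.1
    rw [Real.volume_closedBall, ENNReal.div_lt_iff (Or.inl (by simpa using hr.1))
      (Or.inl ENNReal.ofReal_ne_top), ← ENNReal.ofReal_mul (by positivity)] at h2
    rw [measureReal_def]
    refine ENNReal.toReal_le_of_le_ofReal (by have := hr.1; positivity) (h2.le.trans (le_of_eq ?_))
    congr 1
    ring
  set M := μ.real univ
  refine ⟨ε * r₀ ^ 2 / (2 * (M + 1)), by positivity, fun y hy hy' => ?_⟩
  have hy : 0 < y := hy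
  have hB := Metric.isClosed_closedBall.measurableSet (s := Metric.closedBall E r₀)
  rw [Real.dist_eq, sub_zero, abs_of_nonneg (integral_nonneg fun t => div_nonneg hy.le
    (hk t y hy).le), ← integral_add_compl hB (integrable_poisson μ E hy)]
  have hnear : ∫ t in Metric.closedBall E r₀, y / ((t - E) ^ 2 + y ^ 2) ∂μ ≤ 2 * (ε / 8) := by
    refine poisson_le_of_measure_closedBall_le _ E _ (fun r hr' => ?_) hy
    rw [measureReal_restrict_apply Metric.isClosed_closedBall.measurableSet]
    rcases le_total r r₀ with h1 | h1
    · exact (measureReal_mono inter_subset_left).trans (hr r ⟨hr', h1⟩)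
    · refine (measureReal_mono inter_subset_right).trans ((hr r₀ ⟨hr₀, le_rfl⟩).trans ?_)
      gcongr
  have hfar : ∫ t in (Metric.closedBall E r₀)ᶜ, y / ((t - E) ^ 2 + y ^ 2) ∂μ ≤ y / r₀ ^ 2 * M := by
    have h1 : ∫ t in (Metric.closedBall E r₀)ᶜ, y / ((t - E) ^ 2 + y ^ 2) ∂μ ≤
        ∫ t in (Metric.closedBall E r₀)ᶜ, y / r₀ ^ 2 ∂μ := by
      refine setIntegral_mono_on (integrable_poisson _ E hy) (integrable_const _) hB.compl fun t ht => ?_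
      rw [mem_compl_iff, Metric.mem_closedBall, not_le, Real.dist_eq] at ht
      have : r₀ ^ 2 ≤ (t - E) ^ 2 := by
        rw [← sq_abs (t - E)]
        gcongr
      gcongr
      nlinarith
    refine h1.trans ?_
    rw [setIntegral_const, smul_eq_mul, mul_comm]
    gcongr
    exact measureReal_mono (subset_univ _)
  have hM : 0 ≤ M := measureReal_nonneg
  have hlt : y / r₀ ^ 2 * M ≤ ε / 2 := by
    rw [Real.dist_eq, sub_zero, abs_of_pos hy, lt_div_iff₀ (by positivity)] at hy'
    rw [div_mul_eq_mul_div, div_le_iff₀ (by positivity)]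
    nlinarith
  linarith

/-- The averages of a measure over intervals are bounded by its Poisson integral. -/
lemma measure_closedBall_le_poisson (μ : Measure ℝ) [IsFiniteMeasure μ] (E : ℝ) {y : ℝ}
    (hy : 0 < y) :
    (μ (Metric.closedBall E y) / volume (Metric.closedBall E y)).toReal ≤
      ∫ t, y / ((t - E) ^ 2 + y ^ 2) ∂μ := by
  have hk : ∀ t : ℝ, 0 < (t - E) ^ 2 + y ^ 2 := fun t => by positivity
  have hint := integrable_poisson μ E hy
  have hB := Metric.isClosed_closedBall.measurableSet (s := Metric.closedBall E y)
  calc (μ (Metric.closedBall E y) / volume (Metric.closedBall E y)).toReal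
      = ∫ t in Metric.closedBall E y, 1 / (2 * y) ∂μ := by
        rw [setIntegral_const, Real.volume_closedBall, ENNReal.toReal_div,
          ENNReal.toReal_ofReal (by positivity), smul_eq_mul, mul_one_div, measureReal_def]
    _ ≤ ∫ t in Metric.closedBall E y, y / ((t - E) ^ 2 + y ^ 2) ∂μ := by
        refine setIntegral_mono_on (integrable_const _) hint.integrableOn hB fun t ht => ?_
        rw [Metric.mem_closedBall, Real.dist_eq] at ht
        have : (t - E) ^ 2 ≤ y ^ 2 := by
          rw [← sq_abs (t - E)]
          gcongr
        rw [div_le_div_iff₀ (by positivity) (hk t)]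
        nlinarith
    _ ≤ _ := setIntegral_le_integral hint (.of_forall fun t => div_nonneg hy.le (hk t).le)

/-- The modulus is controlled by the real part in the sector `|arg u| ≤ π / 4`. -/
lemma norm_le_sqrt_two_mul_re_of_re_sq_nonneg {u : ℂ} (h1 : 0 ≤ u.re) (h2 : 0 ≤ (u ^ 2).re) :
    ‖u‖ ≤ √2 * u.re := by
  rw [← abs_of_nonneg (mul_nonneg (Real.sqrt_nonneg 2) h1)]
  refine le_trans (le_abs_self _) (sq_le_sq.1 ?_)
  rw [mul_pow, Real.sq_sqrt (by norm_num), Complex.sq_norm, Complex.normSq_apply]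
  have : (u ^ 2).re = u.re * u.re - u.im * u.im := by rw [sq, Complex.mul_re]
  nlinarith

/-- Kolmogorov's estimate. If `F` has positive imaginary part, the holomorphic square root of `-i F`
takes values in the sector `|arg u| < π / 4`, so its modulus `√‖F‖` is dominated by its real part,
whose integral over a horizontal segment is controlled by Cauchy's theorem, uniformly in the height
of the segment. -/
lemma integral_sqrt_norm_le {F : ℂ → ℂ} (hF : DifferentiableOn ℂ F {z | 0 < z.im})
    (hpos : ∀ z : ℂ, 0 < z.im → 0 < (F z).im) {M : ℝ}
    (hM : ∀ z : ℂ, 0 < z.im → z.im ≤ 1 → ‖F z‖ ≤ M / z.im) {R : ℝ} (hR : 0 ≤ R) {y : ℝ}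
    (hy : 0 < y) (hy1 : y ≤ 1) :
    ∫⁻ x in Ioc (-R) R, ENNReal.ofReal (√‖F (x + y * Complex.I)‖) ≤
      ENNReal.ofReal (√2 * (√M * (2 * R + 4))) := by
  have hM0 : 0 ≤ M := by
    have := hM Complex.I (by simp) (by simp)
    simp at this
    exact (norm_nonneg _).trans this
  -- the square root of `-i F`
  let G : ℂ → ℂ := fun z => Complex.exp (Complex.log (-Complex.I * F z) / 2)
  have hre : ∀ z : ℂ, 0 < z.im → 0 < (-Complex.I * F z).re := fun z hz => by
    simpa using hpos z hz
  have hG : DifferentiableOn ℂ G {z | 0 < z.im} := by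
    refine (DifferentiableOn.clog (hF.const_mul _) fun z hz => Or.inl (hre z hz)).div_const 2 |>.cexp
  have hG2 : ∀ z : ℂ, 0 < z.im → G z ^ 2 = -Complex.I * F z := fun z hz => by
    have hne : -Complex.I * F z ≠ 0 := fun h => by
      have := hre z hz
      rw [h] at this
      simp at this
    simp only [G]
    rw [← Complex.exp_nat_mul]
    push_cast
    rw [mul_div_cancel₀ _ (by norm_num), Complex.exp_log hne]
  have hGn : ∀ z : ℂ, 0 < z.im → ‖G z‖ = √‖F z‖ := fun z hz => by
    rw [eq_comm, Real.sqrt_eq_iff_mul_self_eq (norm_nonneg _) (norm_nonneg _), ← sq, ← norm_pow,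
      hG2 z hz]
    simp
  have hGre : ∀ z : ℂ, 0 < z.im → ‖G z‖ ≤ √2 * (G z).re := fun z hz => by
    refine norm_le_sqrt_two_mul_re_of_re_sq_nonneg ?_ (by rw [hG2 z hz]; exact (hre z hz).le)
    simp only [G]
    rw [Complex.exp_re]
    refine mul_nonneg (Real.exp_nonneg _) (Real.cos_nonneg_of_mem_Icc ?_)
    have h1 : (Complex.log (-Complex.I * F z) / 2).im = (-Complex.I * F z).arg / 2 := by
      rw [Complex.div_ofNat_im, Complex.log_im]
    rw [h1]
    have h2 := Complex.neg_pi_lt_arg (-Complex.I * F z)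
    have h3 := Complex.arg_le_pi (-Complex.I * F z)
    constructor <;> linarith
  have hline : ∀ y : ℝ, 0 < y → Continuous fun x : ℝ => G (x + y * Complex.I) := fun y hy => by
    refine hG.continuousOn.comp_continuous (by fun_prop) fun x => ?_
    simpa using hy
  -- Cauchy's theorem on the rectangle with corners `-R + iy` and `R + i`
  have hrect := Complex.integral_boundary_rect_eq_zero_of_differentiableOn G
    (-R + y * Complex.I) (R + Complex.I) (hG.mono fun z hz => by
      have := hz.2
      simp only [Complex.add_im, Complex.neg_im, Complex.ofReal_im, Complex.im_ofReal_mul,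
        Complex.I_im, mul_one, neg_zero, zero_add, mem_preimage, uIcc_of_le hy1] at this
      exact hy.trans_le this.1)
  simp only [Complex.add_im, Complex.neg_im, Complex.ofReal_im, Complex.im_ofReal_mul,
    Complex.I_im, mul_one, neg_zero, zero_add, Complex.add_re, Complex.neg_re, Complex.ofReal_re,
    Complex.re_ofReal_mul, Complex.I_re, mul_zero, add_zero] at hrect
  have hside : ∀ c : ℝ, ‖∫ s : ℝ in y..1, G (c + s * Complex.I)‖ ≤ 2 * √M := fun c => by
    have hi : IntervalIntegrable (fun s : ℝ => √M * s ^ (-(1 / 2) : ℝ)) volume y 1 :=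
      (intervalIntegral.intervalIntegrable_rpow' (by norm_num)).const_mul _
    refine (intervalIntegral.norm_integral_le_of_norm_le hy1 (.of_forall fun s hs => ?_) hi).trans ?_
    · have hs0 : 0 < s := hy.trans hs.1
      have h1 := hM (c + s * Complex.I) (by simpa using hs0) (by simpa using hs.2)
      have h2 : (c + s * Complex.I).im = s := by simp
      rw [hGn _ (by simpa using hs0)]
      rw [h2] at h1
      refine (Real.sqrt_le_sqrt h1).trans (le_of_eq ?_)
      rw [Real.sqrt_div hM0, Real.rpow_neg hs0.le, ← Real.sqrt_eq_rpow]
      rfl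
    · rw [intervalIntegral.integral_const_mul, integral_rpow (Or.inl (by norm_num)), mul_comm]
      gcongr
      have := Real.rpow_nonneg hy.le (1 / 2)
      norm_num
      norm_num at this
      linarith
  have htop : ‖∫ x : ℝ in (-R)..R, G (x + (1 : ℝ) * Complex.I)‖ ≤ √M * (2 * R) := by
    refine (intervalIntegral.norm_integral_le_of_norm_le_const (C := √M) fun x _ => ?_).trans ?_
    · have h1 := hM (x + (1 : ℝ) * Complex.I) (by simp) (by simp)
      rw [hGn _ (by simp)]
      refine Real.sqrt_le_sqrt (h1.trans (le_of_eq ?_))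
      simp
    · rw [abs_of_nonneg (by linarith)]
      apply le_of_eq
      ring
  have hbot : ‖∫ x : ℝ in (-R)..R, G (x + y * Complex.I)‖ ≤ √M * (2 * R + 4) := by
    have h1 : ∫ x : ℝ in (-R)..R, G (x + y * Complex.I) =
        (∫ x : ℝ in (-R)..R, G (x + (1 : ℝ) * Complex.I)) -
        Complex.I • (∫ s : ℝ in y..1, G ((R : ℝ) + s * Complex.I)) +
        Complex.I • (∫ s : ℝ in y..1, G ((-R : ℝ) + s * Complex.I)) := by
      rw [← sub_eq_zero, ← hrect]
      ring
    rw [h1]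
    refine (norm_add_le _ _).trans ((add_le_add (norm_sub_le _ _) le_rfl).trans ?_)
    rw [norm_smul, norm_smul, Complex.norm_I, one_mul, one_mul]
    linarith [hside R, hside (-R), htop]
  have hle : ∫ x in Ioc (-R) R, √‖F (x + y * Complex.I)‖ ≤ √2 * (√M * (2 * R + 4)) := by
    have hint : IntegrableOn (fun x : ℝ => G (x + y * Complex.I)) (Ioc (-R) R) :=
      ((hline y hy).integrableOn_Icc).mono_set Ioc_subset_Icc_self
    calc ∫ x in Ioc (-R) R, √‖F (x + y * Complex.I)‖
        = ∫ x in Ioc (-R) R, ‖G (x + y * Complex.I)‖ := by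
          congr 1
          funext x
          rw [hGn _ (by simpa using hy)]
      _ ≤ ∫ x in Ioc (-R) R, √2 * (G (x + y * Complex.I)).re :=
          integral_mono hint.norm (hint.re.const_mul _) fun x => hGre _ (by simpa using hy)
      _ = √2 * (∫ x in Ioc (-R) R, G (x + y * Complex.I)).re := by
          rw [integral_const_mul]
          congr 1
          exact integral_re hint
      _ ≤ _ := by
          gcongr
          rw [← intervalIntegral.integral_of_le (by linarith)]
          exact (Complex.re_le_norm _).trans hbot
  rw [← ofReal_integral_eq_lintegral_ofReal]
  · exact ENNReal.ofReal_le_ofReal hle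
  · refine (((hline y hy).norm.integrableOn_Icc).mono_set Ioc_subset_Icc_self).congr
      (.of_forall fun x => ?_)
    exact hGn _ (by simpa using hy)
  · exact .of_forall fun x => Real.sqrt_nonneg _

/-- A function with positive imaginary part and controlled growth does not tend to infinity along
vertical lines, except over a null set, by Fatou's lemma and Kolmogorov's estimate. This is all that
is needed about boundary values; their existence is not. -/
lemma ae_frequently_norm_le {F : ℂ → ℂ} (hF : DifferentiableOn ℂ F {z | 0 < z.im})
    (hpos : ∀ z : ℂ, 0 < z.im → 0 < (F z).im) {M : ℝ}
    (hM : ∀ z : ℂ, 0 < z.im → z.im ≤ 1 → ‖F z‖ ≤ M / z.im) :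
    ∀ᵐ x : ℝ, ∃ C : ℝ, ∃ᶠ n : ℕ in atTop, ‖F (x + (1 / ((n : ℝ) + 1) : ℝ) * Complex.I)‖ ≤ C := by
  let u : ℕ → ℝ → ℝ≥0∞ := fun n x =>
    ENNReal.ofReal (√‖F (x + (1 / ((n : ℝ) + 1) : ℝ) * Complex.I)‖)
  have hpos' : ∀ n : ℕ, (0 : ℝ) < 1 / ((n : ℝ) + 1) := fun n => by positivity
  have hu : ∀ n, Measurable (u n) := fun n => by
    refine ENNReal.measurable_ofReal.comp (Continuous.measurable ?_)
    refine (Continuous.norm ?_).sqrt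
    refine hF.continuousOn.comp_continuous (by fun_prop) fun x => ?_
    rw [mem_ofPred_eq, Complex.add_im, Complex.ofReal_im, Complex.im_ofReal_mul, Complex.I_im,
      zero_add, mul_one]
    exact hpos' n
  have key : ∀ k : ℕ, ∀ᵐ x ∂(volume.restrict (Ioc (-(k : ℝ)) k)),
      liminf (fun n => u n x) atTop < ∞ := fun k => by
    refine ae_lt_top (.liminf hu) (ne_top_of_le_ne_top (b := ENNReal.ofReal
      (√2 * (√M * (2 * (k : ℝ) + 4)))) ENNReal.ofReal_ne_top ?_)
    refine (lintegral_liminf_le hu).trans ?_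
    refine liminf_le_of_frequently_le' (.of_forall fun n => ?_)
    refine integral_sqrt_norm_le hF hpos hM k.cast_nonneg (hpos' n) ?_
    rw [div_le_one (by positivity)]
    linarith [(Nat.cast_nonneg n : (0 : ℝ) ≤ n)]
  have key' : ∀ᵐ x : ℝ, ∀ k : ℕ, x ∈ Ioc (-(k : ℝ)) k → liminf (fun n => u n x) atTop < ∞ :=
    ae_all_iff.2 fun k => (ae_restrict_iff' measurableSet_Ioc).1 (key k)
  filter_upwards [key'] with x hx
  obtain ⟨k, hk⟩ := exists_nat_gt |x|
  have h1 := hx k ⟨(abs_lt.1 hk).1, (abs_lt.1 hk).2.le⟩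
  obtain ⟨c, hc1, hc2⟩ := exists_between h1
  refine ⟨c.toReal ^ 2, (frequently_lt_of_liminf_lt (by isBoundedDefault) hc1).mono fun n hn => ?_⟩
  have h2 : √‖F (x + (1 / ((n : ℝ) + 1) : ℝ) * Complex.I)‖ ≤ c.toReal :=
    (ENNReal.ofReal_le_iff_le_toReal hc2.ne).1 hn.le
  exact (Real.sqrt_le_left ENNReal.toReal_nonneg).1 h2

/-- Let the Stieltjes transforms `m₀` of `μ` and `m₁` of `ν` satisfy `m₀ (q - z - m₁) = 1`. Then the
density of `ν` vanishes almost everywhere on any set on which the density of `μ` does: the relation gives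
`Im m₀ = (Im z + Im m₁) / |q - z - m₁|²`, the denominator stays bounded along a sequence of points
tending vertically to almost every `E`, and `Im m₀` tends to zero where `μ` has zero density. Hence so
does `Im m₁` along that sequence, and `Im m₁` bounds the averages of `ν` over intervals. -/
theorem ae_rnDeriv_eq_zero_of_stieltjes_relation {μ ν : Measure ℝ} [IsFiniteMeasure μ]
    [IsFiniteMeasure ν] (q : ℝ)
    (hrel : ∀ z : ℂ, 0 < z.im →
      (∫ t : ℝ, ((t : ℂ) - z)⁻¹ ∂μ) * (q - z - ∫ t : ℝ, ((t : ℂ) - z)⁻¹ ∂ν) = 1)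
    {S : Set ℝ} (hS : ∀ᵐ E : ℝ, E ∈ S → μ.rnDeriv volume E = 0) :
    ∀ᵐ E : ℝ, E ∈ S → ν.rnDeriv volume E = 0 := by
  let m : ℂ → ℂ := fun z => ∫ t : ℝ, ((t : ℂ) - z)⁻¹ ∂ν
  have hmn : ∀ z : ℂ, 0 < z.im → ‖m z‖ ≤ ν.real univ / z.im := fun z hz => by
    have h1 := norm_integral_le_of_norm_le_const (μ := ν)
      (.of_forall fun t => norm_inv_ofReal_sub_le hz.ne' t)
    rwa [abs_of_pos hz, inv_mul_eq_div] at h1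
  have hmi : ∀ E y : ℝ, 0 < y → (m (E + y * Complex.I)).im = ∫ t, y / ((t - E) ^ 2 + y ^ 2) ∂ν :=
    fun E y hy => im_integral_inv_ofReal_sub ν E hy.ne'
  have hmi' : ∀ z : ℂ, 0 < z.im → 0 ≤ (m z).im := fun z hz => by
    have h1 := hmi z.re z.im hz
    rw [Complex.re_add_im] at h1
    rw [h1]
    exact integral_nonneg fun t => by positivity
  have hmd : DifferentiableOn ℂ m {z | 0 < z.im} := fun z hz => by
    have h1 : z ∉ algebraMap ℝ ℂ '' ν.support := by
      rintro ⟨t, -, rfl⟩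
      simp at hz
    have h2 := (hasDerivAt_resolventTransform (μ := ν) z h1).differentiableAt
    refine (h2.congr_of_eventuallyEq (.of_forall fun w => ?_)).differentiableWithinAt
    simp only [m, resolventTransform, resolvent, Ring.inverse_eq_inv']
    rfl
  have hy : ∀ n : ℕ, (0 : ℝ) < 1 / ((n : ℝ) + 1) := fun n => by positivity
  have hytend : Tendsto (fun n : ℕ => 1 / ((n : ℝ) + 1)) atTop (𝓝[>] 0) :=
    tendsto_nhdsWithin_iff.2 ⟨tendsto_one_div_add_atTop_nhds_zero_nat, .of_forall hy⟩
  -- adding `i` makes the imaginary part strictly positive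
  have hfreq := ae_frequently_norm_le (F := fun z => m z + Complex.I) (M := ν.real univ + 1)
    (hmd.add_const _)
    (fun z hz => by
      rw [Complex.add_im, Complex.I_im]
      linarith [hmi' z hz])
    (fun z hz hz1 => by
      refine (norm_add_le _ _).trans ?_
      rw [Complex.norm_I, add_div]
      refine add_le_add (hmn z hz) ?_
      rwa [le_div_iff₀ hz, one_mul])
  filter_upwards [hS, hfreq, Besicovitch.ae_tendsto_rnDeriv μ volume,
    Besicovitch.ae_tendsto_rnDeriv ν volume, ν.rnDeriv_lt_top volume] with E h1 h2 h3 h4 h5 hE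
  rw [h1 hE] at h3
  obtain ⟨C, hC⟩ := h2
  have hup := (tendsto_poisson_zero μ E h3).comp hytend
  have hlow := ((ENNReal.tendsto_toReal h5.ne).comp h4).comp hytend
  by_contra hne
  have hpos : 0 < (ν.rnDeriv volume E).toReal := ENNReal.toReal_pos hne h5.ne
  set D : ℝ := |q| + |E| + 1 + (C + 1)
  have hup' := hup.const_mul (D ^ 2)
  rw [mul_zero] at hup'
  have hev := (tendsto_order.1 hup').2 _ (half_pos hpos)
  have hev' := (tendsto_order.1 hlow).1 _ (half_lt_self hpos)
  obtain ⟨n, hCn, hn1, hn2⟩ := (hC.and_eventually (hev.and hev')).exists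
  simp only [Function.comp_apply] at hn1 hn2
  set y : ℝ := 1 / ((n : ℝ) + 1) with hy_def
  have hy0 : 0 < y := hy n
  have hy1 : y ≤ 1 := by
    rw [hy_def, div_le_one (by positivity)]
    linarith [(Nat.cast_nonneg n : (0 : ℝ) ≤ n)]
  have hlow' := measure_closedBall_le_poisson ν E hy0
  rw [← hmi E y hy0] at hlow'
  rw [← im_integral_inv_ofReal_sub μ E hy0.ne'] at hn1
  set z : ℂ := E + y * Complex.I with hz
  have hzim : z.im = y := by simp [hz]
  have hr := hrel z (by rw [hzim]; exact hy0)
  set d : ℂ := q - z - m z with hd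
  have hd' : (∫ t : ℝ, ((t : ℂ) - z)⁻¹ ∂μ) = d⁻¹ := eq_inv_of_mul_eq_one_left hr
  have hd0 : d ≠ 0 := right_ne_zero_of_mul_eq_one hr
  have hdim : d.im = -(y + (m z).im) := by
    rw [hd, Complex.sub_im, Complex.sub_im, Complex.ofReal_im, hzim]
    ring
  have hmz : ‖m z‖ ≤ C + 1 := by
    calc ‖m z‖ = ‖(m z + Complex.I) - Complex.I‖ := by rw [add_sub_cancel_right]
      _ ≤ ‖m z + Complex.I‖ + ‖Complex.I‖ := norm_sub_le _ _
      _ ≤ C + 1 := by rw [Complex.norm_I]; gcongr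
  have hdn : ‖d‖ ≤ D := by
    have hzn : ‖z‖ ≤ |E| + 1 := by
      refine (norm_add_le _ _).trans ?_
      rw [norm_mul, Complex.norm_I, mul_one, Complex.norm_real, Complex.norm_real, Real.norm_eq_abs,
        Real.norm_eq_abs, abs_of_pos hy0]
      linarith
    refine (norm_sub_le _ _).trans ((add_le_add (norm_sub_le _ _) hmz).trans ?_)
    rw [Complex.norm_real, Real.norm_eq_abs]
    linarith
  rw [hd', Complex.inv_im, hdim, neg_neg, Complex.normSq_eq_norm_sq] at hn1
  have hdpos : 0 < ‖d‖ ^ 2 := by positivity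
  have hge : y + (m z).im ≤ D ^ 2 * ((y + (m z).im) / ‖d‖ ^ 2) := by
    rw [mul_div_assoc', le_div_iff₀ hdpos, mul_comm]
    have := hmi' z (by rw [hzim]; exact hy0)
    gcongr
  linarith

end BoundaryValues

/-! ### Self-adjointness of Schrödinger operators on graphs of bounded degree -/

section Schrodinger

open Filter Topology

variable {X : Type*} (G : SimpleGraph X) [G.LocallyFinite] (q : X → ℝ)

lemma memℓp_two_iff {ι : Type*} {f : ι → ℂ} : Memℓp f 2 ↔ Summable fun x => ‖f x‖ ^ 2 := by
  rw [memℓp_gen_iff (by norm_num)]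
  norm_num

lemma formalSchrodinger_apply (f : X → ℂ) (x : X) :
    formalSchrodinger G q f x = (∑ y ∈ G.neighborFinset x, f y) + (q x : ℂ) * f x := rfl

lemma mem_domain_schrodinger {ψ : ℓ²(X, ℂ)} :
    ψ ∈ (schrodinger G q).domain ↔ Memℓp (formalSchrodinger G q (ψ : X → ℂ)) 2 := Iff.rfl

lemma schrodinger_apply (ψ : (schrodinger G q).domain) (x : X) :
    (schrodinger G q ψ : X → ℂ) x =
      (∑ y ∈ G.neighborFinset x, (ψ : ℓ²(X, ℂ)) y) + (q x : ℂ) * (ψ : ℓ²(X, ℂ)) x := rfl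

variable {G} {D : ℕ}

/-- On a graph with degrees at most `D`, summing over neighbours maps `ℓ¹` to itself, as every vertex
is counted at most `D` times. -/
lemma summable_sum_neighborFinset (hD : ∀ x, G.degree x ≤ D) {g : X → ℝ} (hg : ∀ x, 0 ≤ g x)
    (h : Summable g) : Summable fun x => ∑ y ∈ G.neighborFinset x, g y := by
  classical
  refine summable_of_sum_le (c := D * ∑' y, g y) (fun x => Finset.sum_nonneg fun y _ => hg y)
    fun s => ?_
  rw [Finset.sum_comm' (t' := s.biUnion fun x => G.neighborFinset x)
    (s' := fun y => s.filter fun x => G.Adj x y)]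
  · calc ∑ y ∈ s.biUnion fun x => G.neighborFinset x, ∑ _x ∈ s.filter (fun x => G.Adj x y), g y
        ≤ ∑ y ∈ s.biUnion fun x => G.neighborFinset x, D * g y := by
          refine Finset.sum_le_sum fun y _ => ?_
          rw [Finset.sum_const, nsmul_eq_mul]
          refine mul_le_mul_of_nonneg_right ?_ (hg y)
          refine Nat.cast_le.2 (le_trans (Finset.card_le_card fun x hx => ?_) (hD y))
          rw [SimpleGraph.mem_neighborFinset]
          exact (Finset.mem_filter.1 hx).2.symm
      _ ≤ D * ∑' y, g y := by
          rw [← Finset.mul_sum]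
          gcongr
          exact h.sum_le_tsum _ fun y _ => hg y
  · intro x y
    simp only [SimpleGraph.mem_neighborFinset, Finset.mem_filter, Finset.mem_biUnion]
    exact ⟨fun ⟨h1, h2⟩ => ⟨⟨h1, h2⟩, x, h1, h2⟩, fun ⟨h1, _⟩ => h1⟩

/-- The adjacency operator of a graph of bounded degree on `ℓ²`. -/
noncomputable def adjacencyL2 (hD : ∀ x, G.degree x ≤ D) (ψ : ℓ²(X, ℂ)) : ℓ²(X, ℂ) :=
  ⟨fun x => ∑ y ∈ G.neighborFinset x, ψ y, by
    change Memℓp _ 2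
    rw [memℓp_two_iff]
    have h1 := (summable_sum_neighborFinset hD (fun x => sq_nonneg ‖ψ x‖)
      (memℓp_two_iff.1 (lp.memℓp ψ))).mul_left (D : ℝ)
    refine Summable.of_nonneg_of_le (fun x => sq_nonneg _) (fun x => ?_) h1
    calc ‖∑ y ∈ G.neighborFinset x, ψ y‖ ^ 2 ≤ (∑ y ∈ G.neighborFinset x, ‖ψ y‖) ^ 2 := by
          gcongr
          exact norm_sum_le _ _
      _ ≤ (G.neighborFinset x).card * ∑ y ∈ G.neighborFinset x, ‖ψ y‖ ^ 2 :=
          sq_sum_le_card_mul_sum_sq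
      _ ≤ D * ∑ y ∈ G.neighborFinset x, ‖ψ y‖ ^ 2 := by
          gcongr
          exact hD x⟩

lemma adjacencyL2_apply (hD : ∀ x, G.degree x ≤ D) (ψ : ℓ²(X, ℂ)) (x : X) :
    (adjacencyL2 hD ψ : X → ℂ) x = ∑ y ∈ G.neighborFinset x, ψ y := rfl

lemma inner_adjacencyL2 (hD : ∀ x, G.degree x ≤ D) (φ χ : ℓ²(X, ℂ)) :
    inner ℂ (adjacencyL2 hD φ) χ = inner ℂ φ (adjacencyL2 hD χ) := by
  classical
  -- the double sum over edges converges absolutely, so that the summations may be interchanged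
  have hadj : ∀ ψ : ℓ²(X, ℂ), Summable fun p : X × X => if G.Adj p.1 p.2 then ‖ψ p.1‖ ^ 2 else 0 :=
    fun ψ => by
      have hfin : ∀ x, ∀ y ∉ G.neighborFinset x, (if G.Adj x y then ‖ψ x‖ ^ 2 else 0) = 0 :=
        fun x y hy => if_neg fun h => hy ((G.mem_neighborFinset x y).2 h)
      rw [summable_prod_of_nonneg fun p => by split_ifs <;> positivity]
      refine ⟨fun x => summable_of_ne_finset_zero (hfin x), ?_⟩
      refine Summable.of_nonneg_of_le (fun x => tsum_nonneg fun y => by split_ifs <;> positivity)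
        (fun x => ?_) ((memℓp_two_iff.1 (lp.memℓp ψ)).mul_left (D : ℝ))
      rw [tsum_eq_sum (hfin x), Finset.sum_congr rfl fun y hy =>
        if_pos ((G.mem_neighborFinset x y).1 hy), Finset.sum_const, nsmul_eq_mul]
      gcongr
      exact hD x
  have hswap : Summable fun p : X × X => if G.Adj p.1 p.2 then ‖φ p.2‖ ^ 2 else 0 := by
    have := (Equiv.prodComm X X).summable_iff.2 (hadj φ)
    refine this.congr fun p => ?_
    simp [G.adj_comm p.2 p.1]
  let k : X → X → ℂ := fun x y => if G.Adj x y then inner ℂ (φ y) (χ x) else 0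
  have hk : Summable (Function.uncurry k) := by
    refine Summable.of_norm_bounded ((hadj χ).add hswap) fun p => ?_
    simp only [Function.uncurry, k]
    split_ifs with h
    · refine (norm_inner_le_norm _ _).trans ?_
      nlinarith [sq_nonneg (‖φ p.2‖ - ‖χ p.1‖), sq_nonneg (‖φ p.2‖ + ‖χ p.1‖)]
    · simp
  have h1 : ∀ x, ∑' y, k x y = inner ℂ (adjacencyL2 hD φ x) (χ x) := fun x => by
    rw [tsum_eq_sum (s := G.neighborFinset x) fun y hy =>
      if_neg fun h => hy ((G.mem_neighborFinset x y).2 h), adjacencyL2_apply, sum_inner]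
    exact Finset.sum_congr rfl fun y hy => if_pos ((G.mem_neighborFinset x y).1 hy)
  have h2 : ∀ y, ∑' x, k x y = inner ℂ (φ y) (adjacencyL2 hD χ y) := fun y => by
    rw [tsum_eq_sum (s := G.neighborFinset y) fun x hx =>
      if_neg fun h => hx ((G.mem_neighborFinset y x).2 h.symm), adjacencyL2_apply, inner_sum]
    exact Finset.sum_congr rfl fun x hx => if_pos ((G.mem_neighborFinset y x).1 hx).symm
  rw [lp.inner_eq_tsum, lp.inner_eq_tsum, ← tsum_congr h1, ← tsum_congr h2]
  exact hk.tsum_comm.symm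

variable {q}

/-- The form of the multiplication by `q`, as the difference of the forms of `T + q` and of the bounded
operator `T`; no separate assumption on `q` is needed for the sum to converge. -/
lemma inner_schrodinger_sub (hD : ∀ x, G.degree x ≤ D) (φ : (schrodinger G q).domain)
    (χ : ℓ²(X, ℂ)) :
    HasSum (fun x => (q x : ℂ) * inner ℂ ((φ : ℓ²(X, ℂ)) x) (χ x))
      (inner ℂ (schrodinger G q φ) χ - inner ℂ (adjacencyL2 hD φ) χ) := by
  have h1 : HasSum (fun x => (inner ℂ (schrodinger G q φ x) (χ x) : ℂ))
    (inner ℂ (schrodinger G q φ) χ) := lp.hasSum_inner _ _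
  have h2 : HasSum (fun x => (inner ℂ (adjacencyL2 hD (φ : ℓ²(X, ℂ)) x) (χ x) : ℂ))
    (inner ℂ (adjacencyL2 hD (φ : ℓ²(X, ℂ))) χ) := lp.hasSum_inner _ _
  have h3 : (fun x => (q x : ℂ) * inner ℂ ((φ : ℓ²(X, ℂ)) x) (χ x)) = fun x =>
      (inner ℂ (schrodinger G q φ x) (χ x) : ℂ) -
        inner ℂ (adjacencyL2 hD (φ : ℓ²(X, ℂ)) x) (χ x) := by
    funext x
    rw [schrodinger_apply, adjacencyL2_apply, inner_add_left, add_sub_cancel_left]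
    simp
    ring
  rw [h3]
  exact h1.sub h2

lemma schrodinger_symm (hD : ∀ x, G.degree x ≤ D) (φ χ : (schrodinger G q).domain) :
    inner ℂ (schrodinger G q φ) (χ : ℓ²(X, ℂ)) = inner ℂ (φ : ℓ²(X, ℂ)) (schrodinger G q χ) := by
  have h1 := inner_schrodinger_sub hD φ χ
  have h2 := (Complex.hasSum_conj'.2 (inner_schrodinger_sub hD χ φ))
  rw [map_sub, inner_conj_symm, inner_conj_symm] at h2
  have h3 : (fun x => (q x : ℂ) * inner ℂ ((φ : ℓ²(X, ℂ)) x) ((χ : ℓ²(X, ℂ)) x)) =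
      fun x => starRingEnd ℂ ((q x : ℂ) * inner ℂ ((χ : ℓ²(X, ℂ)) x) ((φ : ℓ²(X, ℂ)) x)) := by
    funext x
    rw [map_mul, Complex.conj_ofReal, inner_conj_symm]
  rw [h3] at h1
  replace h3 := h1.unique h2
  rw [inner_adjacencyL2] at h3
  exact sub_left_injective h3

/-- The delta function at a vertex. -/
noncomputable def delta (x : X) : ℓ²(X, ℂ) :=
  open Classical in lp.single 2 x 1

open Classical in
lemma inner_delta (x : X) (χ : ℓ²(X, ℂ)) : inner ℂ (delta x) χ = χ x := by
  unfold delta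
  rw [lp.inner_single_left]
  simp

lemma delta_apply_ne {x y : X} (h : y ≠ x) : (delta x : X → ℂ) y = 0 := by
  classical
  simp [delta, h]

lemma formalSchrodinger_delta (hD : ∀ x, G.degree x ≤ D) (x : X) :
    formalSchrodinger G q (delta x : X → ℂ) =
      (adjacencyL2 hD (delta x) + (q x : ℂ) • delta x : ℓ²(X, ℂ)) := by
  classical
  funext y
  rw [formalSchrodinger_apply, lp.coeFn_add, Pi.add_apply, adjacencyL2_apply, lp.coeFn_smul,
    Pi.smul_apply, smul_eq_mul]
  congr 1
  by_cases h : y = x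
  · rw [h]
  · have : (delta x : X → ℂ) y = 0 := by
      unfold delta
      exact lp.single_apply_ne 2 x _ h
    rw [this, mul_zero, mul_zero]

/-- The range of `A - z` is closed since `A - z` is bounded below and `A` is closed; a vector orthogonal
to it is tested against delta functions and found to be an eigenvector of `A` for the eigenvalue
`z̄`, hence zero by symmetry. -/
lemma schrodinger_surj (hD : ∀ x, G.degree x ≤ D) {z : ℂ} (hz : z.im ≠ 0) (ψ : ℓ²(X, ℂ)) :
    ∃ φ : (schrodinger G q).domain, schrodinger G q φ - z • (φ : ℓ²(X, ℂ)) = ψ := by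
  set A := schrodinger G q
  let L : A.domain →ₗ[ℂ] ℓ²(X, ℂ) := A.toFun - z • A.domain.subtype
  have hL : ∀ φ, L φ = A φ - z • (φ : ℓ²(X, ℂ)) := fun φ => rfl
  have hbound : ∀ φ : A.domain, |z.im| * ‖(φ : ℓ²(X, ℂ))‖ ≤ ‖L φ‖ := fun φ =>
    abs_im_mul_norm_le_of_symm (schrodinger_symm hD) z φ
  have hz' : 0 < |z.im| := abs_pos.2 hz
  have hclosed : IsClosed (LinearMap.range L : Set ℓ²(X, ℂ)) := by
    refine IsSeqClosed.isClosed fun u ψ hu hψ => ?_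
    choose φ hφ using hu
    have hc : CauchySeq fun n => (φ n : ℓ²(X, ℂ)) := by
      rw [Metric.cauchySeq_iff]
      intro ε hε
      obtain ⟨N, hN⟩ := Metric.cauchySeq_iff.1 hψ.cauchySeq (|z.im| * ε) (by positivity)
      refine ⟨N, fun m hm n hn => ?_⟩
      have h1 := hN m hm n hn
      rw [dist_eq_norm, ← hφ, ← hφ, ← map_sub] at h1
      have h2 := (hbound (φ m - φ n)).trans_lt h1
      rw [dist_eq_norm]
      exact lt_of_mul_lt_mul_left h2 hz'.le
    obtain ⟨φ', hφ'⟩ := cauchySeq_tendsto_of_complete hc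
    have heval : ∀ (v : ℕ → ℓ²(X, ℂ)) (w : ℓ²(X, ℂ)), Tendsto v atTop (𝓝 w) → ∀ x,
        Tendsto (fun n => v n x) atTop (𝓝 (w x)) := fun v w h x =>
      ((lp.lipschitzWith_one_eval 2 x).continuous.tendsto w).comp h
    have hpt : formalSchrodinger G q (φ' : X → ℂ) = (ψ + z • φ' : ℓ²(X, ℂ)) := by
      funext x
      have h1 : Tendsto (fun n => A (φ n) x) atTop (𝓝 (formalSchrodinger G q (φ' : X → ℂ) x)) :=
        (tendsto_finsetSum _ fun y _ => heval _ _ hφ' y).add ((heval _ _ hφ' x).const_mul _)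
      have h2 : ∀ n, A (φ n) = u n + z • (φ n : ℓ²(X, ℂ)) := fun n => by
        rw [← hφ, hL]; abel
      simp_rw [h2] at h1
      exact tendsto_nhds_unique h1 (heval _ _ (hψ.add (hφ'.const_smul z)) x)
    have hmem : φ' ∈ A.domain := by
      rw [mem_domain_schrodinger, hpt]
      exact lp.memℓp _
    refine ⟨⟨φ', hmem⟩, ?_⟩
    rw [hL]
    have : A ⟨φ', hmem⟩ = ψ + z • φ' := lp.ext hpt
    rw [this, add_sub_cancel_right]
  suffices h : LinearMap.range L = ⊤ by
    have h1 : ψ ∈ LinearMap.range L := by rw [h]; trivial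
    exact h1
  have : CompleteSpace (LinearMap.range L) := hclosed.completeSpace_coe
  rw [← Submodule.orthogonal_eq_bot_iff, Submodule.eq_bot_iff]
  intro χ hχ
  have hpt : formalSchrodinger G q (χ : X → ℂ) = (star z • χ : ℓ²(X, ℂ)) := by
    funext x
    have hmem : delta x ∈ A.domain := by
      rw [mem_domain_schrodinger, formalSchrodinger_delta hD]
      exact lp.memℓp (adjacencyL2 hD (delta x) + (q x : ℂ) • delta x)
    have h1 := hχ (L ⟨delta x, hmem⟩) (LinearMap.mem_range_self _ _)
    have h2 : A ⟨delta x, hmem⟩ = adjacencyL2 hD (delta x) + (q x : ℂ) • delta x :=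
      lp.ext (formalSchrodinger_delta hD x)
    rw [hL, h2, inner_sub_left, inner_add_left, inner_smul_left, inner_smul_left,
      inner_adjacencyL2, inner_delta, inner_delta, Complex.conj_ofReal] at h1
    rw [formalSchrodinger_apply, ← adjacencyL2_apply hD, sub_eq_zero.1 h1]
    rfl
  have hmem : χ ∈ A.domain := by
    rw [mem_domain_schrodinger, hpt]
    exact lp.memℓp _
  have h3 := abs_im_mul_norm_le_of_symm (schrodinger_symm hD) (star z) (⟨χ, hmem⟩ : A.domain)
  have h4 : schrodinger G q ⟨χ, hmem⟩ = star z • χ := lp.ext hpt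
  rw [h4, sub_self, norm_zero] at h3
  have h5 : 0 < |(star z).im| := by simpa using hz
  exact norm_le_zero_iff.1 (nonpos_of_mul_nonpos_right h3 h5)

/-- On a graph of bounded degree, the Schrödinger operator with an arbitrary real potential is
self-adjoint on its maximal domain. -/
theorem isSelfAdjointOp_schrodinger (hD : ∀ x, G.degree x ≤ D) (q : X → ℝ) :
    IsSelfAdjointOp (schrodinger G q) :=
  ⟨schrodinger_symm hD, fun _ hz ψ => schrodinger_surj hD hz ψ⟩

end Schrodinger

/-! ### Densities of spectral measures and the absolutely continuous spectrum -/

section AbsolutelyContinuousSpectrum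

open Filter Topology

lemma measure_compl_acSpectrum {E : Type*} [NormedAddCommGroup E] [InnerProductSpace ℂ E]
    {A : E →ₗ.[ℂ] E} {ψ : E} {μ : Measure ℝ} (h : IsSpectralMeasure A ψ μ) (hac : μ ≪ volume) :
    μ (acSpectrum A)ᶜ = 0 := by
  refine measure_mono_null (Set.compl_subset_compl.2 ?_) (Measure.measure_compl_support (μ := μ))
  exact fun t ht => subset_closure ⟨ψ, μ, h, hac, ht⟩

variable {E : Type*} [NormedAddCommGroup E] [InnerProductSpace ℂ E] [CompleteSpace E]

/-- Off the absolutely continuous spectrum every spectral measure has zero density, because its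
absolutely continuous part is a spectral measure as well. -/
theorem IsSelfAdjointOp.ae_rnDeriv_eq_zero {A : E →ₗ.[ℂ] E} (hA : IsSelfAdjointOp A) {ψ : E}
    {μ : Measure ℝ} (hμ : IsSpectralMeasure A ψ μ) :
    ∀ᵐ t : ℝ, t ∈ (acSpectrum A)ᶜ → μ.rnDeriv volume t = 0 := by
  have := hμ.1
  have hO : MeasurableSet (acSpectrum A)ᶜ := isClosed_closure.measurableSet.compl
  obtain ⟨s, hs, hs0, hsc⟩ := Measure.mutuallySingular_singularPart μ volume
  have hdec := Measure.haveLebesgueDecomposition_add μ volume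
  have hres : μ.restrict s ≪ volume := by
    rw [hdec, Measure.restrict_add, Measure.restrict_eq_zero.2 hs0, zero_add]
    exact (Measure.absolutelyContinuous_of_le Measure.restrict_le_self).trans
      (withDensity_absolutelyContinuous _ _)
  obtain ⟨χ, hχ⟩ := hA.exists_isSpectralMeasure_restrict hμ hs
  have h1 := measure_compl_acSpectrum hχ hres
  rw [Measure.restrict_apply hO] at h1
  have h2 : (volume.withDensity (μ.rnDeriv volume)) ((acSpectrum A)ᶜ ∩ s) = 0 :=
    le_antisymm ((Measure.withDensity_rnDeriv_le μ volume _).trans h1.le) zero_le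
  rw [withDensity_apply _ (hO.inter hs), lintegral_eq_zero_iff (Measure.measurable_rnDeriv _ _),
    EventuallyEq, ae_restrict_iff' (hO.inter hs)] at h2
  filter_upwards [h2, measure_eq_zero_iff_ae_notMem.1 hsc] with t h3 h4 h5
  exact h3 ⟨h5, not_not.1 h4⟩

lemma mutuallySingular_restrict_of_ae_rnDeriv_eq_zero {μ ν : Measure ℝ} [IsFiniteMeasure ν]
    (hμ : μ ≪ volume) {S : Set ℝ}
    (h : ∀ᵐ t : ℝ, t ∈ S → ν.rnDeriv volume t = 0) : ν ⟂ₘ μ.restrict S := by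
  have hac : μ.restrict S ≪ volume :=
    (Measure.absolutelyContinuous_of_le Measure.restrict_le_self).trans hμ
  rw [Measure.haveLebesgueDecomposition_add ν volume]
  refine Measure.MutuallySingular.add_left
    ((Measure.mutuallySingular_singularPart ν volume).mono_ac .rfl hac) ?_
  have hm : MeasurableSet {t | ν.rnDeriv volume t = 0} :=
    Measure.measurable_rnDeriv _ _ (measurableSet_singleton 0)
  refine ⟨_, hm, ?_, ?_⟩
  · rw [withDensity_apply _ hm]
    exact (setLIntegral_congr_fun hm fun t ht => ht).trans lintegral_zero
  · rw [Measure.restrict_apply hm.compl]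
    refine hμ (measure_eq_zero_iff_ae_notMem.2 ?_)
    filter_upwards [h] with t ht h1
    exact h1.1 (ht h1.2)

end AbsolutelyContinuousSpectrum

/-! ### The half-line operator -/

section HalfLine

lemma neighborFinset_halfLine_zero : halfLine.neighborFinset 0 = {1} := by
  ext m
  rw [SimpleGraph.mem_neighborFinset, Finset.mem_singleton]
  simp only [halfLine]
  omega

lemma neighborFinset_halfLine_succ (n : ℕ) : halfLine.neighborFinset (n + 1) = {n, n + 2} := by
  ext m
  rw [SimpleGraph.mem_neighborFinset, Finset.mem_insert, Finset.mem_singleton]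
  simp only [halfLine]
  omega

lemma degree_halfLine_le (n : ℕ) : halfLine.degree n ≤ 2 := by
  unfold SimpleGraph.degree
  cases n with
  | zero => simp [neighborFinset_halfLine_zero]
  | succ n => rw [neighborFinset_halfLine_succ]; exact Finset.card_le_two

lemma formalSchrodinger_halfLine_zero (q : ℕ → ℝ) (f : ℕ → ℂ) :
    formalSchrodinger halfLine q f 0 = f 1 + q 0 * f 0 := by
  rw [formalSchrodinger_apply, neighborFinset_halfLine_zero, Finset.sum_singleton]

lemma formalSchrodinger_halfLine_succ (q : ℕ → ℝ) (f : ℕ → ℂ) (n : ℕ) :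
    formalSchrodinger halfLine q f (n + 1) = f n + f (n + 2) + q (n + 1) * f (n + 1) := by
  rw [formalSchrodinger_apply, neighborFinset_halfLine_succ, Finset.sum_pair (by omega)]

lemma isSelfAdjointOp_halfLine (q : ℕ → ℝ) : IsSelfAdjointOp (schrodinger halfLine q) :=
  isSelfAdjointOp_schrodinger degree_halfLine_le q

lemma delta_apply_self {X : Type*} (x : X) : (delta x : X → ℂ) x = 1 := by
  classical
  simp [delta]

/-- The pointwise form of the resolvent equation. -/
lemma formalSchrodinger_resolventOp (q : ℕ → ℝ) {z : ℂ} (hz : z.im ≠ 0) (ψ : ℓ²(ℕ, ℂ)) (n : ℕ) :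
    formalSchrodinger halfLine q (resolventOp (schrodinger halfLine q) z ψ : ℕ → ℂ) n =
      z * (resolventOp (schrodinger halfLine q) z ψ : ℕ → ℂ) n + ψ n := by
  obtain ⟨φ, h1, h2⟩ := (isSelfAdjointOp_halfLine q).exists_eq_resolventOp hz ψ
  have h3 : schrodinger halfLine q φ = z • (φ : ℓ²(ℕ, ℂ)) + ψ := by rw [← h2]; abel
  rw [← h1]
  exact congrArg (fun f : ℓ²(ℕ, ℂ) => f n) h3

/-- Coefficient stripping: the diagonal Green functions at the origin for a potential and for its
shift are related by `m₀ (q₀ - z - m₁) = 1`. The reason is that `φ = (A - z)⁻¹ δ₀`, restricted to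
the sites `n ≥ 1`, is `-φ₀` times the corresponding vector for the shifted potential. -/
theorem green_mul_green_shift (q : ℕ → ℝ) {z : ℂ} (hz : z.im ≠ 0) :
    (inner ℂ (delta 0) (resolventOp (schrodinger halfLine q) z (delta 0)) : ℂ) *
      (q 0 - z - inner ℂ (delta 0)
        (resolventOp (schrodinger halfLine fun n => q (n + 1)) z (delta 0))) = 1 := by
  set φ := resolventOp (schrodinger halfLine q) z (delta 0)
  have hφ := formalSchrodinger_resolventOp q hz (delta 0)
  have h0 := hφ 0
  rw [formalSchrodinger_halfLine_zero, delta_apply_self] at h0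
  have hs : ∀ n, φ n + φ (n + 2) + q (n + 1) * φ (n + 1) = z * φ (n + 1) := fun n => by
    have h1 := hφ (n + 1)
    rwa [formalSchrodinger_halfLine_succ, delta_apply_ne (by omega), add_zero] at h1
  have hmem : Memℓp (fun n => φ (n + 1)) 2 := by
    rw [memℓp_two_iff]
    exact (summable_nat_add_iff 1).2 (memℓp_two_iff.1 (lp.memℓp φ))
  let φ' : ℓ²(ℕ, ℂ) := ⟨fun n => φ (n + 1), hmem⟩
  have hpt : formalSchrodinger halfLine (fun n => q (n + 1)) (φ' : ℕ → ℂ) =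
      (z • φ' - φ 0 • delta 0 : ℓ²(ℕ, ℂ)) := by
    funext n
    have hr : (z • φ' - φ 0 • delta 0 : ℓ²(ℕ, ℂ)) n =
        z * φ (n + 1) - φ 0 * (delta 0 : ℕ → ℂ) n := rfl
    rw [hr]
    cases n with
    | zero =>
      rw [formalSchrodinger_halfLine_zero, delta_apply_self]
      have := hs 0
      change φ 2 + q 1 * φ 1 = _
      linear_combination this
    | succ n =>
      rw [formalSchrodinger_halfLine_succ, delta_apply_ne (by omega)]
      have := hs (n + 1)
      change φ (n + 1) + φ (n + 3) + q (n + 2) * φ (n + 2) = _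
      linear_combination this
  have hdom : φ' ∈ (schrodinger halfLine fun n => q (n + 1)).domain := by
    rw [mem_domain_schrodinger, hpt]
    exact lp.memℓp _
  have hR := (isSelfAdjointOp_halfLine fun n => q (n + 1)).eq_resolventOp hz ⟨φ', hdom⟩
  have hA : schrodinger halfLine (fun n => q (n + 1)) ⟨φ', hdom⟩ = z • φ' - φ 0 • delta 0 :=
    lp.ext hpt
  rw [hA, sub_right_comm, sub_self, zero_sub, map_neg, map_smul] at hR
  have h1 := congrArg (fun f : ℓ²(ℕ, ℂ) => inner ℂ (delta 0) f) hR
  simp only [inner_neg_right, inner_smul_right] at h1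
  rw [inner_delta 0 φ'] at h1
  rw [inner_delta]
  have h2 : (φ' : ℕ → ℂ) 0 = φ 1 := rfl
  rw [h2] at h1
  linear_combination h0 + h1

/-- The vector at the origin is cyclic for the half-line operator: if `χ` is orthogonal to its cyclic
subspace, then `(A - z)⁻¹ χ` vanishes at `0` for all `z`, and the resolvent equation shows inductively
that every further coordinate does not depend on `z`, hence vanishes too. -/
theorem eq_zero_of_inner_delta_resolventOp (q : ℕ → ℝ) {χ : ℓ²(ℕ, ℂ)}
    (h : ∀ z : ℂ, z.im ≠ 0 →
      inner ℂ (delta 0) (resolventOp (schrodinger halfLine q) z χ) = (0 : ℂ)) : χ = 0 := by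
  set R := resolventOp (schrodinger halfLine q)
  have hA := isSelfAdjointOp_halfLine q
  -- a coordinate of the resolvent that does not depend on `z` vanishes, as it tends to zero
  have hconst : ∀ (n : ℕ) (c : ℂ), (∀ z : ℂ, z.im ≠ 0 → (R z χ : ℕ → ℂ) n = c) → c = 0 := by
    intro n c hc
    by_contra hne
    have hc0 : 0 < ‖c‖ := norm_pos_iff.2 hne
    set y : ℝ := (‖χ‖ + 1) / ‖c‖
    have hy : 0 < y := by positivity
    have h1 : ((y : ℂ) * Complex.I).im ≠ 0 := by simpa using hy.ne'
    have h2 := lp.norm_apply_le_norm (by norm_num) (R (y * Complex.I) χ) n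
    rw [hc _ h1] at h2
    have h3 := ((R (y * Complex.I)).le_opNorm χ).trans
      (mul_le_mul_of_nonneg_right (hA.norm_resolventOp_le h1) (norm_nonneg χ))
    have h4 : |((y : ℂ) * Complex.I).im| = y := by simpa using hy.le
    rw [h4, inv_mul_eq_div] at h3
    have h5 := (le_div_iff₀ hy).1 (h2.trans h3)
    have h6 : ‖c‖ * y = ‖χ‖ + 1 := mul_div_cancel₀ _ hc0.ne'
    linarith
  have hall : ∀ n : ℕ, (∀ z : ℂ, z.im ≠ 0 → (R z χ : ℕ → ℂ) n = 0) ∧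
      ∀ z : ℂ, z.im ≠ 0 → (R z χ : ℕ → ℂ) (n + 1) = 0 := by
    intro n
    induction n with
    | zero =>
      have h0 : ∀ z : ℂ, z.im ≠ 0 → (R z χ : ℕ → ℂ) 0 = 0 := fun z hz => by
        rw [← inner_delta, h z hz]
      have h1 : ∀ z : ℂ, z.im ≠ 0 → (R z χ : ℕ → ℂ) (0 + 1) = χ 0 := fun z hz => by
        have := formalSchrodinger_resolventOp q hz χ 0
        rw [formalSchrodinger_halfLine_zero, h0 z hz] at this
        linear_combination this
      refine ⟨h0, fun z hz => ?_⟩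
      rw [h1 z hz, hconst _ _ h1]
    | succ n ih =>
      have h1 : ∀ z : ℂ, z.im ≠ 0 → (R z χ : ℕ → ℂ) (n + 2) = χ (n + 1) := fun z hz => by
        have := formalSchrodinger_resolventOp q hz χ (n + 1)
        rw [formalSchrodinger_halfLine_succ, ih.1 z hz, ih.2 z hz] at this
        linear_combination this
      refine ⟨ih.2, fun z hz => ?_⟩
      rw [h1 z hz, hconst _ _ h1]
  refine hA.resolventOp_injective (z := Complex.I) (by simp) (lp.ext ?_)
  funext n
  exact (hall n).1 _ (by simp)

/-- If the spectral measure of the vector at the origin has zero density on `S`, then no vector has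
absolutely continuous spectral measure charging `S`. -/
theorem measure_eq_zero_of_ae_rnDeriv_eq_zero {q : ℕ → ℝ} {μ₀ μ : Measure ℝ} {ψ : ℓ²(ℕ, ℂ)}
    (hμ₀ : IsSpectralMeasure (schrodinger halfLine q) (delta 0) μ₀) {S : Set ℝ}
    (hS : MeasurableSet S) (h : ∀ᵐ t : ℝ, t ∈ S → μ₀.rnDeriv volume t = 0)
    (hμ : IsSpectralMeasure (schrodinger halfLine q) ψ μ) (hac : μ ≪ volume) : μ S = 0 := by
  have hA := isSelfAdjointOp_halfLine q
  have := hμ₀.1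
  obtain ⟨χ, hχ⟩ := hA.exists_isSpectralMeasure_restrict hμ hS
  have hsing := mutuallySingular_restrict_of_ae_rnDeriv_eq_zero hac h
  have hχ0 : χ = 0 := eq_zero_of_inner_delta_resolventOp q fun z hz =>
    hA.inner_resolventOp_eq_zero hμ₀ hχ hsing hz
  rw [hχ0] at hχ
  exact Measure.restrict_eq_zero.1 (hA.isSpectralMeasure_unique hχ hA.isSpectralMeasure_zero)

/-- Shifting the potential of a half-line operator does not create absolutely continuous
spectrum: by coefficient stripping, one site at a time. -/
theorem ae_rnDeriv_shift_eq_zero (q : ℕ → ℝ) (k : ℕ) {μ : Measure ℝ}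
    (hμ : IsSpectralMeasure (schrodinger halfLine fun n => q (k + n)) (delta 0) μ) :
    ∀ᵐ t : ℝ, t ∈ (acSpectrum (schrodinger halfLine q))ᶜ → μ.rnDeriv volume t = 0 := by
  induction k generalizing μ with
  | zero =>
    simp only [zero_add] at hμ
    exact (isSelfAdjointOp_halfLine q).ae_rnDeriv_eq_zero hμ
  | succ k ih =>
    obtain ⟨ν, hν⟩ :=
      (isSelfAdjointOp_halfLine fun n => q (k + n)).exists_isSpectralMeasure (delta 0)
    have hfin := hμ.1
    have hfin' := hν.1
    refine ae_rnDeriv_eq_zero_of_stieltjes_relation (μ := ν) (q (k + 0)) (fun z hz => ?_) (ih hν)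
    have h1 := green_mul_green_shift (fun n => q (k + n)) hz.ne'
    have hq : (fun n => q (k + 1 + n)) = fun n => q (k + (n + 1)) := by
      funext n
      congr 1
      ring
    rw [hq] at hμ
    rw [(isSelfAdjointOp_halfLine _).isSpectralMeasure_iff] at hμ hν
    rwa [hν.2 z hz.ne', hμ.2 z hz.ne'] at h1

end HalfLine

/-! ### Isometries intertwining self-adjoint operators -/

section Intertwining

variable {E F : Type*} [NormedAddCommGroup E] [InnerProductSpace ℂ E] [NormedAddCommGroup F]
  [InnerProductSpace ℂ F] {A : E →ₗ.[ℂ] E} {B : F →ₗ.[ℂ] F}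

/-- The isometry `J` maps the operator `s B` onto a part of `A`. -/
def Intertwines (A : E →ₗ.[ℂ] E) (B : F →ₗ.[ℂ] F) (s : ℝ) (J : F →ₗᵢ[ℂ] E) : Prop :=
  ∀ φ : B.domain, ∃ φ' : A.domain, (φ' : E) = J φ ∧ A φ' = (s : ℂ) • J (B φ)

namespace Intertwines

variable {s : ℝ} {J : F →ₗᵢ[ℂ] E} (hJ : Intertwines A B s J) (hA : IsSelfAdjointOp A)
  (hB : IsSelfAdjointOp B) (hs : 0 < s)
include hJ hA hB hs

lemma resolventOp_apply {z : ℂ} (hz : z.im ≠ 0) (ψ : F) :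
    resolventOp A (s * z) (J ψ) = (s : ℂ)⁻¹ • J (resolventOp B z ψ) := by
  obtain ⟨φ, h1, h2⟩ := hB.exists_eq_resolventOp hz ψ
  obtain ⟨φ', h3, h4⟩ := hJ φ
  have hs' : (s : ℂ) ≠ 0 := by exact_mod_cast hs.ne'
  have hz' : (s * z : ℂ).im ≠ 0 := by
    rw [Complex.im_ofReal_mul]
    exact mul_ne_zero hs.ne' hz
  have h5 := hA.eq_resolventOp hz' φ'
  have h6 : A φ' - (s * z : ℂ) • (φ' : E) = (s : ℂ) • J ψ := by
    rw [h4, h3, ← h2, map_sub, map_smul, smul_sub, smul_smul]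
  rw [h6, map_smul, h3, h1] at h5
  rw [← h5, smul_smul, inv_mul_cancel₀ hs', one_smul]

/-- Spectral measures are transported along intertwining isometries. -/
theorem isSpectralMeasure_map {ψ : F} {μ : Measure ℝ} (h : IsSpectralMeasure B ψ μ) :
    IsSpectralMeasure A (J ψ) (μ.map fun t => s * t) := by
  rw [hB.isSpectralMeasure_iff] at h
  rw [hA.isSpectralMeasure_iff]
  have := h.1
  have hs' : (s : ℂ) ≠ 0 := by exact_mod_cast hs.ne'
  refine ⟨inferInstance, fun z hz => ?_⟩
  have hz' : (z / s : ℂ).im ≠ 0 := by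
    rw [Complex.div_ofReal_im]
    exact div_ne_zero hz hs.ne'
  have h1 := hJ.resolventOp_apply hA hB hs hz' ψ
  rw [mul_div_cancel₀ _ hs'] at h1
  rw [h1, inner_smul_right, J.inner_map_map, h.2 _ hz', integral_map (by fun_prop)
    (continuous_inv_ofReal_sub hz).aestronglyMeasurable, ← integral_const_mul]
  congr 1
  funext t
  have h2 : ((s * t : ℝ) : ℂ) - z = s * (t - z / s) := by
    push_cast
    field_simp
  rw [h2, mul_inv]

variable [CompleteSpace E] [CompleteSpace F]

lemma adjoint_resolventOp {w : ℂ} (hw : w.im ≠ 0) (x : E) :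
    J.toContinuousLinearMap.adjoint (resolventOp A w x) =
      (s : ℂ)⁻¹ • resolventOp B (w / s) (J.toContinuousLinearMap.adjoint x) := by
  have hs' : (s : ℂ) ≠ 0 := by exact_mod_cast hs.ne'
  have hw' : (w / s : ℂ).im ≠ 0 := by
    rw [Complex.div_ofReal_im]
    exact div_ne_zero hw hs.ne'
  have hw'' : (star (w / s)).im ≠ 0 := by simpa using hw'
  refine ext_inner_left ℂ fun ψ => ?_
  have h1 := hJ.resolventOp_apply hA hB hs hw'' ψ
  have h2 : (s : ℂ) * star (w / s) = star w := by
    rw [star_div₀]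
    have : star (s : ℂ) = s := Complex.conj_ofReal s
    rw [this, mul_div_cancel₀ _ hs']
  rw [h2] at h1
  rw [ContinuousLinearMap.adjoint_inner_right, LinearIsometry.coe_toContinuousLinearMap,
    ← star_star w, ← hA.inner_resolventOp_left (by simpa using hw), h1, inner_smul_left,
    inner_smul_right, star_star, ← star_star (w / s : ℂ), ← hB.inner_resolventOp_left hw'',
    ContinuousLinearMap.adjoint_inner_right, LinearIsometry.coe_toContinuousLinearMap, map_inv₀,
    Complex.conj_ofReal, star_star]

/-- The component of a vector in the range of an intertwining isometry has at most the spectral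
measure of the vector. -/
theorem spectralMeasure_map_adjoint_le {ψ : E} {μ ν : Measure ℝ} (hμ : IsSpectralMeasure A ψ μ)
    (hν : IsSpectralMeasure B (J.toContinuousLinearMap.adjoint ψ) ν) :
    ν.map (fun t => s * t) ≤ μ := by
  have hs' : (s : ℂ) ≠ 0 := by exact_mod_cast hs.ne'
  let P : E →L[ℂ] E := J.toContinuousLinearMap ∘L J.toContinuousLinearMap.adjoint
  have hPapp : ∀ x, P x = J (J.toContinuousLinearMap.adjoint x) := fun x => rfl
  have hJJ : ∀ y, J.toContinuousLinearMap.adjoint (J y) = y := fun y =>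
    ext_inner_left ℂ fun x => by
      rw [ContinuousLinearMap.adjoint_inner_right, LinearIsometry.coe_toContinuousLinearMap,
        J.inner_map_map]
  have hP : IsStarProjection P := by
    refine ⟨?_, ?_⟩
    · ext x
      change P (P x) = P x
      rw [hPapp, hPapp, hJJ]
    · rw [isSelfAdjoint_iff, ContinuousLinearMap.star_eq_adjoint]
      simp only [P]
      rw [ContinuousLinearMap.adjoint_comp, ContinuousLinearMap.adjoint_adjoint]
  have hcomm : ∀ z : ℂ, z.im ≠ 0 → P * resolventOp A z = resolventOp A z * P := fun z hz => by
    ext x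
    change P (resolventOp A z x) = resolventOp A z (P x)
    have hz' : (z / s : ℂ).im ≠ 0 := by
      rw [Complex.div_ofReal_im]
      exact div_ne_zero hz hs.ne'
    have h1 := hJ.resolventOp_apply hA hB hs hz' (J.toContinuousLinearMap.adjoint x)
    rw [mul_div_cancel₀ _ hs'] at h1
    rw [hPapp, hPapp, hJ.adjoint_resolventOp hA hB hs hz, h1, map_smul]
  exact hA.spectralMeasure_projection_le hP hcomm hμ
    (hJ.isSpectralMeasure_map hA hB hs hν)

end Intertwines

end Intertwining

/-! ### Decomposition of the rooted tree -/

section Tree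

variable {K : ℕ}

lemma neighborFinset_rootedTree_nil :
    (rootedTree K).neighborFinset [] = Finset.univ.image fun a : Fin K => [a] := by
  ext y
  rw [SimpleGraph.mem_neighborFinset, Finset.mem_image]
  simp [rootedTree, eq_comm]

lemma neighborFinset_rootedTree_cons (b : Fin K) (u : List (Fin K)) :
    (rootedTree K).neighborFinset (b :: u) =
      insert u (Finset.univ.image fun a : Fin K => a :: b :: u) := by
  ext y
  rw [SimpleGraph.mem_neighborFinset, Finset.mem_insert, Finset.mem_image]
  constructor
  · rintro (⟨a, rfl⟩ | ⟨a, h⟩)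
    · exact Or.inr ⟨a, Finset.mem_univ _, rfl⟩
    · exact Or.inl (List.cons.inj h).2.symm
  · rintro (rfl | ⟨a, -, rfl⟩)
    · exact Or.inr ⟨b, rfl⟩
    · exact Or.inl ⟨a, rfl⟩

lemma sum_neighborFinset_rootedTree_nil (f : List (Fin K) → ℂ) :
    ∑ y ∈ (rootedTree K).neighborFinset [], f y = ∑ a, f [a] := by
  rw [neighborFinset_rootedTree_nil, Finset.sum_image]
  intro a _ b _ h
  simpa using h

lemma sum_neighborFinset_rootedTree_cons (f : List (Fin K) → ℂ) (b : Fin K) (u : List (Fin K)) :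
    ∑ y ∈ (rootedTree K).neighborFinset (b :: u), f y = f u + ∑ a, f (a :: b :: u) := by
  rw [neighborFinset_rootedTree_cons, Finset.sum_insert, Finset.sum_image]
  · intro a _ b _ h
    simpa using h
  · rw [Finset.mem_image]
    rintro ⟨a, -, h⟩
    have := congrArg List.length h
    simp only [List.length_cons] at this
    omega

lemma degree_rootedTree_le (x : List (Fin K)) : (rootedTree K).degree x ≤ K + 1 := by
  unfold SimpleGraph.degree
  cases x with
  | nil =>
    rw [neighborFinset_rootedTree_nil]
    refine Finset.card_image_le.trans ?_
    simp
  | cons b u =>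
    rw [neighborFinset_rootedTree_cons]
    refine (Finset.card_insert_le _ _).trans
      (Nat.add_le_add_right (Finset.card_image_le.trans ?_) 1)
    simp

lemma isSelfAdjointOp_rootedTree (V : List (Fin K) → ℝ) :
    IsSelfAdjointOp (schrodinger (rootedTree K) V) :=
  isSelfAdjointOp_schrodinger degree_rootedTree_le V

/-- The vertices at distance `m` from the root. -/
noncomputable def level (K m : ℕ) : Finset (List (Fin K)) :=
  (List.finite_length_eq (Fin K) m).toFinset

lemma mem_level {m : ℕ} {u : List (Fin K)} : u ∈ level K m ↔ u.length = m := by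
  simp [level]

lemma sum_level_zero {M : Type*} [AddCommMonoid M] (f : List (Fin K) → M) :
    ∑ u ∈ level K 0, f u = f [] := by
  have : level K 0 = {[]} := by
    ext u
    rw [mem_level, Finset.mem_singleton, List.length_eq_zero_iff]
  rw [this, Finset.sum_singleton]

lemma sum_level_succ {M : Type*} [AddCommMonoid M] (m : ℕ) (f : List (Fin K) → M) :
    ∑ u ∈ level K (m + 1), f u = ∑ u ∈ level K m, ∑ b, f (b :: u) := by
  classical
  have : level K (m + 1) = (level K m ×ˢ (Finset.univ : Finset (Fin K))).image
      fun p => p.2 :: p.1 := by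
    ext u
    rw [mem_level, Finset.mem_image]
    constructor
    · intro h
      cases u with
      | nil => simp at h
      | cons b u =>
        exact ⟨(u, b), Finset.mem_product.2 ⟨mem_level.2 (by simpa using h), Finset.mem_univ _⟩, rfl⟩
    · rintro ⟨⟨u, b⟩, h, rfl⟩
      have := mem_level.1 (Finset.mem_product.1 h).1
      simpa using this
  rw [this, Finset.sum_image, Finset.sum_product]
  rintro ⟨u, b⟩ - ⟨u', b'⟩ - h
  simp only [List.cons.injEq] at h
  rw [h.1, h.2]

lemma hasSum_of_hasSum_level {f : List (Fin K) → ℝ} (hf : ∀ u, 0 ≤ f u) {s : ℝ}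
    (h : HasSum (fun m => ∑ u ∈ level K m, f u) s) : HasSum f s := by
  let e := Equiv.sigmaFiberEquiv (List.length : List (Fin K) → ℕ)
  rw [← e.hasSum_iff]
  have hfib : ∀ m : ℕ, HasSum (fun c : {u : List (Fin K) // u.length = m} => f c)
      (∑ u ∈ level K m, f u) := fun m => by
    let : Fintype {u : List (Fin K) // u.length = m} :=
      Fintype.subtype (level K m) fun u => mem_level
    rw [Finset.sum_subtype (level K m) (fun u => mem_level) f]
    exact hasSum_fintype _
  refine HasSum.sigma_of_hasSum h (fun m => hfib m) ?_
  refine (summable_sigma_of_nonneg (f := f ∘ e) fun c => hf _).2 ⟨fun m => (hfib m).summable, ?_⟩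
  refine h.summable.congr fun m => ?_
  exact (hfib m).tsum_eq.symm

/-- A profile of generation `n` is a function on the tree which vanishes before generation `n`, is
constant along the descendants of each vertex of generation `n`, whose values on the children of
every vertex of generation `n - 1` cancel, and which is normalized on generation `n`. Modulating
radial functions by a profile decouples the subtrees from their common ancestor. -/
structure IsProfile (n : ℕ) (a : List (Fin K) → ℝ) : Prop where
  eq_zero_of_lt : ∀ u, u.length < n → a u = 0
  cons_eq : ∀ b u, n ≤ u.length → a (b :: u) = a u
  sum_cons : ∀ u, u.length + 1 = n → ∑ b, a (b :: u) = 0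
  sum_sq : ∑ u ∈ level K n, a u ^ 2 = 1

/-- The sum of a function over the children of a vertex. -/
def childSum (f : List (Fin K) → ℂ) (u : List (Fin K)) : ℂ := ∑ b, f (b :: u)

/-- The function on the tree with values `a u K^(-j/2) f j` on the generation `n + j`. -/
noncomputable def profileMap (n : ℕ) (a : List (Fin K) → ℝ) (f : ℕ → ℂ) (u : List (Fin K)) : ℂ :=
  a u * ((√(K : ℝ) : ℂ)⁻¹ ^ (u.length - n) * f (u.length - n))

lemma profileMap_add (n : ℕ) (a : List (Fin K) → ℝ) (f g : ℕ → ℂ) :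
    profileMap n a (f + g) = profileMap n a f + profileMap n a g := by
  funext u
  simp only [profileMap, Pi.add_apply]
  ring

lemma profileMap_smul (n : ℕ) (a : List (Fin K) → ℝ) (c : ℂ) (f : ℕ → ℂ) :
    profileMap n a (c • f) = c • profileMap n a f := by
  funext u
  simp only [profileMap, Pi.smul_apply, smul_eq_mul]
  ring

lemma hasSum_norm_sq {ι : Type*} (f : ℓ²(ι, ℂ)) : HasSum (fun x => ‖f x‖ ^ 2) (‖f‖ ^ 2) := by
  have h : HasSum (fun x => ‖f x‖ ^ (2 : ℝ≥0∞).toReal) (‖f‖ ^ (2 : ℝ≥0∞).toReal) :=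
    lp.hasSum_norm (by norm_num) f
  simpa only [ENNReal.toReal_ofNat, Real.rpow_ofNat] using h

namespace IsProfile

variable {n : ℕ} {a : List (Fin K) → ℝ} (ha : IsProfile n a)
include ha

lemma sum_level_sq (j : ℕ) : ∑ u ∈ level K (n + j), a u ^ 2 = (K : ℝ) ^ j := by
  induction j with
  | zero => simpa using ha.sum_sq
  | succ j ih =>
    rw [← add_assoc, sum_level_succ]
    have : ∀ u ∈ level K (n + j), ∑ b, a (b :: u) ^ 2 = K * a u ^ 2 := fun u hu => by
      rw [mem_level] at hu
      rw [Finset.sum_congr rfl fun b _ => by rw [ha.cons_eq b u (by omega)]]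
      simp
    rw [Finset.sum_congr rfl this, ← Finset.mul_sum, ih, pow_succ, mul_comm]

lemma sum_level_mul (j : ℕ) (f : List (Fin K) → ℂ) :
    ∑ u ∈ level K (n + j), (a u : ℂ) * f u = ∑ u ∈ level K n, (a u : ℂ) * childSum^[j] f u := by
  induction j generalizing f with
  | zero => rfl
  | succ j ih =>
    rw [← add_assoc, sum_level_succ, Function.iterate_succ_apply, ← ih]
    refine Finset.sum_congr rfl fun u hu => ?_
    rw [mem_level] at hu
    rw [childSum, Finset.mul_sum]
    exact Finset.sum_congr rfl fun b _ => by rw [ha.cons_eq b u (by omega)]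

lemma hasSum_norm_sq_profileMap (hK : 0 < K) {f : ℕ → ℂ} {s : ℝ}
    (hf : HasSum (fun m => ‖f m‖ ^ 2) s) : HasSum (fun u => ‖profileMap n a f u‖ ^ 2) s := by
  have hK' : (0 : ℝ) < K := by exact_mod_cast hK
  refine hasSum_of_hasSum_level (fun u => sq_nonneg _) ?_
  have hlt : ∀ m ∈ Finset.range n, ∑ u ∈ level K m, ‖profileMap n a f u‖ ^ 2 = 0 := fun m hm =>
    Finset.sum_eq_zero fun u hu => by
      rw [mem_level] at hu
      rw [profileMap, ha.eq_zero_of_lt u (by rw [hu]; exact Finset.mem_range.1 hm)]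
      simp
  have hge : ∀ j, ∑ u ∈ level K (j + n), ‖profileMap n a f u‖ ^ 2 = ‖f j‖ ^ 2 := fun j => by
    have h1 : ∀ u ∈ level K (j + n), ‖profileMap n a f u‖ ^ 2 =
        a u ^ 2 * (((K : ℝ) ^ j)⁻¹ * ‖f j‖ ^ 2) := fun u hu => by
      rw [mem_level] at hu
      rw [profileMap, hu, Nat.add_sub_cancel, norm_mul, norm_mul, norm_pow, norm_inv,
        Complex.norm_real, Complex.norm_real, Real.norm_eq_abs, Real.norm_eq_abs,
        abs_of_nonneg (Real.sqrt_nonneg _), mul_pow, mul_pow, sq_abs, ← pow_mul, mul_comm j 2,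
        pow_mul, inv_pow, Real.sq_sqrt hK'.le, inv_pow]
    rw [Finset.sum_congr rfl h1, ← Finset.sum_mul, add_comm, ha.sum_level_sq,
      mul_inv_cancel_left₀ (by positivity)]
  rw [← hasSum_nat_add_iff' n, Finset.sum_eq_zero hlt, sub_zero]
  simp_rw [hge]
  exact hf

/-- `profileMap` as a map from `ℓ²(ℕ)` to `ℓ²` of the tree. -/
noncomputable def toL2 (hK : 0 < K) (φ : ℓ²(ℕ, ℂ)) : ℓ²(List (Fin K), ℂ) :=
  ⟨profileMap n a φ, memℓp_two_iff.2
    (ha.hasSum_norm_sq_profileMap hK (hasSum_norm_sq φ)).summable⟩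

lemma coe_toL2 (hK : 0 < K) (φ : ℓ²(ℕ, ℂ)) :
    (ha.toL2 hK φ : List (Fin K) → ℂ) = profileMap n a φ := rfl

lemma norm_toL2 (hK : 0 < K) (φ : ℓ²(ℕ, ℂ)) : ‖ha.toL2 hK φ‖ = ‖φ‖ := by
  have h1 := hasSum_norm_sq (ha.toL2 hK φ)
  rw [coe_toL2] at h1
  have h2 := h1.unique (ha.hasSum_norm_sq_profileMap hK (hasSum_norm_sq φ))
  rwa [sq_eq_sq₀ (norm_nonneg _) (norm_nonneg _)] at h2

/-- Radial functions modulated by a profile form an isometric copy of `ℓ²(ℕ)`. -/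
noncomputable def isometry (hK : 0 < K) : ℓ²(ℕ, ℂ) →ₗᵢ[ℂ] ℓ²(List (Fin K), ℂ) where
  toFun := ha.toL2 hK
  map_add' φ χ := lp.ext (profileMap_add n a φ χ)
  map_smul' c φ := lp.ext (profileMap_smul n a c φ)
  norm_map' := ha.norm_toL2 hK

lemma isometry_apply (hK : 0 < K) (φ : ℓ²(ℕ, ℂ)) :
    (ha.isometry hK φ : List (Fin K) → ℂ) = profileMap n a φ := rfl

/-- On modulated radial functions the tree operator acts as `√K` times the half-line operator with the
shifted potential. In the lowest generation `n` there is no contribution from the parent, where the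
profile vanishes; at the parents of that generation the contributions of the children cancel. -/
lemma formalSchrodinger_profileMap (hK : 0 < K) {V : List (Fin K) → ℝ} {v : ℕ → ℝ}
    (hV : ∀ x, V x = v x.length) (f : ℕ → ℂ) (u : List (Fin K)) :
    formalSchrodinger (rootedTree K) V (profileMap n a f) u =
      (√(K : ℝ) : ℂ) * profileMap n a
        (formalSchrodinger halfLine (fun j => v (n + j) / √(K : ℝ)) f) u := by
  have hK' : (0 : ℝ) < K := by exact_mod_cast hK
  have hr : (√(K : ℝ) : ℂ) ≠ 0 := by
    exact_mod_cast (Real.sqrt_pos.2 hK').ne'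
  have hrK : (√(K : ℝ) : ℂ) * √(K : ℝ) = K := by
    exact_mod_cast Real.mul_self_sqrt hK'.le
  have hzero : ∀ g : ℕ → ℂ, ∀ w : List (Fin K), w.length < n → profileMap n a g w = 0 :=
    fun g w hw => by rw [profileMap, ha.eq_zero_of_lt w hw, Complex.ofReal_zero, zero_mul]
  -- the contribution of the children
  have hchild : ∀ w : List (Fin K), ∑ b, profileMap n a f (b :: w) =
      if w.length < n then 0 else
        (√(K : ℝ) : ℂ) * (a w * ((√(K : ℝ) : ℂ)⁻¹ ^ (w.length - n) * f (w.length - n + 1))) := by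
    intro w
    split_ifs with hw
    · rcases Nat.lt_or_ge (w.length + 1) n with h | h
      · exact Finset.sum_eq_zero fun b _ => hzero f _ (by simpa using h)
      · have h1 : w.length + 1 = n := by omega
        have h2 : ∑ b, (a (b :: w) : ℂ) = 0 := by
          exact_mod_cast congrArg (fun x : ℝ => (x : ℂ)) (ha.sum_cons w h1)
        simp only [profileMap, List.length_cons, h1]
        rw [← Finset.sum_mul, h2, zero_mul]
    · have h1 : w.length + 1 - n = w.length - n + 1 := by omega
      simp only [profileMap, List.length_cons, h1, ha.cons_eq _ w (not_lt.1 hw)]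
      rw [Finset.sum_const, Finset.card_univ, Fintype.card_fin, nsmul_eq_mul, ← hrK, pow_succ]
      field_simp
  rcases Nat.lt_or_ge u.length n with hu | hu
  · rw [hzero _ u hu, mul_zero, formalSchrodinger_apply, hzero f u hu, mul_zero, add_zero]
    cases u with
    | nil => rw [sum_neighborFinset_rootedTree_nil, hchild, if_pos hu]
    | cons b u =>
      rw [sum_neighborFinset_rootedTree_cons, hchild, if_pos hu, add_zero]
      exact hzero f u (by simp only [List.length_cons] at hu; omega)
  · obtain ⟨j, hj⟩ := Nat.exists_eq_add_of_le hu
    have hVu : (V u : ℂ) = √(K : ℝ) * ((v (n + j) / √(K : ℝ) : ℝ) : ℂ) := by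
      rw [hV, hj]
      push_cast
      field_simp
    have hju : u.length - n = j := by omega
    have hsum : ∑ y ∈ (rootedTree K).neighborFinset u, profileMap n a f y =
        (√(K : ℝ) : ℂ) * (a u * ((√(K : ℝ) : ℂ)⁻¹ ^ j *
          (if j = 0 then f 1 else f (j - 1) + f (j + 1)))) := by
      cases u with
      | nil =>
        have hj0 : j = 0 := by simp only [List.length_nil] at hj; omega
        rw [sum_neighborFinset_rootedTree_nil, hchild, if_neg (not_lt.2 hu), hju, hj0, if_pos rfl]
      | cons b u =>
        rw [sum_neighborFinset_rootedTree_cons, hchild, if_neg (not_lt.2 hu), hju]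
        simp only [List.length_cons] at hj
        cases j with
        | zero =>
          rw [hzero f u (by omega), zero_add, if_pos rfl]
        | succ j =>
          have h1 : u.length - n = j := by omega
          rw [if_neg (by omega), Nat.add_sub_cancel, profileMap, h1, ha.cons_eq b u (by omega),
            pow_succ]
          field_simp
    rw [formalSchrodinger_apply, hsum, hVu, profileMap, profileMap, hju]
    cases j with
    | zero =>
      rw [formalSchrodinger_halfLine_zero, if_pos rfl]
      ring
    | succ j =>
      rw [formalSchrodinger_halfLine_succ, if_neg (by omega), Nat.add_sub_cancel]
      ring

lemma intertwines (hK : 0 < K) {V : List (Fin K) → ℝ} {v : ℕ → ℝ} (hV : ∀ x, V x = v x.length) :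
    Intertwines (schrodinger (rootedTree K) V)
      (schrodinger halfLine fun j => v (n + j) / √(K : ℝ)) (√(K : ℝ)) (ha.isometry hK) := by
  intro φ
  have hpt : formalSchrodinger (rootedTree K) V (ha.isometry hK φ : List (Fin K) → ℂ) =
      ((√(K : ℝ) : ℂ) • ha.isometry hK (schrodinger halfLine _ φ) : ℓ²(List (Fin K), ℂ)) := by
    funext u
    exact ha.formalSchrodinger_profileMap hK hV φ u
  have hdom : ha.isometry hK φ ∈ (schrodinger (rootedTree K) V).domain := by
    rw [mem_domain_schrodinger, hpt]
    exact lp.memℓp _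
  exact ⟨⟨_, hdom⟩, rfl, lp.ext hpt⟩

/-- A vector `χ` orthogonal to the range of the isometry of a profile `a` satisfies one linear relation
in each generation `n + j`, written in terms of the sums of `χ` over the descendants in that
generation of the vertices of generation `n`. -/
lemma sum_mul_childSum_eq_zero (hK : 0 < K) {χ : ℓ²(List (Fin K), ℂ)}
    (h : (ha.isometry hK).toContinuousLinearMap.adjoint χ = 0) (j : ℕ) :
    ∑ u ∈ level K n, (a u : ℂ) * childSum^[j] χ u = 0 := by
  have hK' : (0 : ℝ) < K := by exact_mod_cast hK
  have hr : (√(K : ℝ) : ℂ) ≠ 0 := by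
    exact_mod_cast (Real.sqrt_pos.2 hK').ne'
  have h1 : inner ℂ (ha.isometry hK (delta j)) χ = (0 : ℂ) := by
    have := ContinuousLinearMap.adjoint_inner_right (ha.isometry hK).toContinuousLinearMap
      (delta j) χ
    rw [h, inner_zero_right] at this
    exact this.symm
  rw [lp.inner_eq_tsum, tsum_eq_sum (s := level K (n + j))] at h1
  · rw [← ha.sum_level_mul]
    refine ((mul_eq_zero (a := (√(K : ℝ) : ℂ)⁻¹ ^ j)).1 ?_).resolve_left
      (pow_ne_zero _ (inv_ne_zero hr))
    rw [Finset.mul_sum, ← h1]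
    refine Finset.sum_congr rfl fun u hu => ?_
    rw [mem_level] at hu
    rw [isometry_apply, profileMap, hu, Nat.add_sub_cancel_left, delta_apply_self, mul_one]
    simp only [RCLike.inner_apply, map_mul, map_pow, map_inv₀, Complex.conj_ofReal]
    ring
  · intro u hu
    rw [mem_level] at hu
    have : profileMap n a (delta j) u = 0 := by
      rcases Nat.lt_or_ge u.length n with h2 | h2
      · rw [profileMap, ha.eq_zero_of_lt u h2, Complex.ofReal_zero, zero_mul]
      · rw [profileMap, delta_apply_ne (by omega), mul_zero, mul_zero]
    rw [isometry_apply, this, inner_zero_left]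

end IsProfile

/-- The constant profile; its modulated functions are the radial ones. -/
lemma isProfile_one : IsProfile (K := K) 0 fun _ => 1 where
  eq_zero_of_lt u h := absurd h (Nat.not_lt_zero _)
  cons_eq _ _ _ := rfl
  sum_cons u h := absurd h (Nat.succ_ne_zero _)
  sum_sq := by rw [sum_level_zero, one_pow]

/-- The profile living, with opposite signs, on the subtrees of two siblings. -/
noncomputable def siblingProfile (x : List (Fin K)) (c d : Fin K) (u : List (Fin K)) : ℝ :=
  ((if c :: x <:+ u then 1 else 0) - if d :: x <:+ u then 1 else 0) / √2

lemma cons_suffix_iff_of_length {x u : List (Fin K)} (c : Fin K) (h : u.length = x.length + 1) :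
    c :: x <:+ u ↔ u = c :: x :=
  ⟨fun h1 => (h1.eq_of_length (by simp [h])).symm, fun h1 => h1 ▸ List.suffix_rfl⟩

lemma isProfile_sibling (x : List (Fin K)) {c d : Fin K} (hcd : c ≠ d) :
    IsProfile (x.length + 1) (siblingProfile x c d) where
  eq_zero_of_lt u hu := by
    have h : ∀ c : Fin K, ¬ c :: x <:+ u := fun c h => by
      have := h.length_le
      simp only [List.length_cons] at this
      omega
    simp [siblingProfile, h]
  cons_eq b u hu := by
    have h : ∀ c : Fin K, c :: x <:+ b :: u ↔ c :: x <:+ u := fun c => by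
      rw [List.suffix_cons_iff]
      refine or_iff_right fun h => ?_
      have := congrArg List.length h
      simp only [List.length_cons] at this
      omega
    simp only [siblingProfile, h]
  sum_cons u hu := by
    have h : ∀ b c : Fin K, c :: x <:+ b :: u ↔ b = c ∧ u = x := fun b c => by
      rw [cons_suffix_iff_of_length c (by simpa using hu), List.cons.injEq]
    simp only [siblingProfile, h]
    rw [← Finset.sum_div, Finset.sum_sub_distrib]
    by_cases hux : u = x <;> simp [hux]
  sum_sq := by
    have h : ∀ u ∈ level K (x.length + 1), siblingProfile x c d u ^ 2 =
        ((if u = c :: x then 1 else 0) + if u = d :: x then 1 else 0) / 2 := fun u hu => by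
      rw [mem_level] at hu
      rw [siblingProfile, div_pow, Real.sq_sqrt (by norm_num)]
      simp only [cons_suffix_iff_of_length _ hu]
      congr 1
      by_cases h1 : u = c :: x
      · have h2 : u ≠ d :: x := fun h2 => hcd (List.cons.inj (h1.symm.trans h2)).1
        simp [h1, hcd]
      · by_cases h2 : u = d :: x <;> simp [h1, h2, hcd.symm]
    have hmem : ∀ c : Fin K, c :: x ∈ level K (x.length + 1) := fun c => mem_level.2 rfl
    rw [Finset.sum_congr rfl h, ← Finset.sum_div, Finset.sum_add_distrib, Finset.sum_ite_eq',
      Finset.sum_ite_eq', if_pos (hmem c), if_pos (hmem d)]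
    norm_num

/-- The radial functions modulated by profiles are jointly total in `ℓ²` of the tree. If `χ` is
orthogonal to all of them, the sum of `χ` over the `j`-th generation of descendants of `u` vanishes,
by induction on `u`: for the root this is orthogonality to radial functions, and the sum for a vertex is
the total of the sums for its children, which are equal by the sibling profiles. -/
theorem eq_zero_of_adjoint_isometry_eq_zero (hK : 0 < K) {χ : ℓ²(List (Fin K), ℂ)}
    (h : ∀ (n : ℕ) (a : List (Fin K) → ℝ) (ha : IsProfile n a),
      (ha.isometry hK).toContinuousLinearMap.adjoint χ = 0) : χ = 0 := by
  have hall : ∀ (u : List (Fin K)) (j : ℕ), childSum^[j] χ u = 0 := by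
    intro u
    induction u with
    | nil =>
      intro j
      have := isProfile_one.sum_mul_childSum_eq_zero hK (h _ _ isProfile_one) j
      rwa [sum_level_zero, Complex.ofReal_one, one_mul] at this
    | cons c x ih =>
      intro j
      -- by the sibling profiles, the sums over the subtrees of siblings agree
      have hsib : ∀ d : Fin K, childSum^[j] χ (d :: x) = childSum^[j] χ (c :: x) := fun d => by
        rcases eq_or_ne c d with rfl | hcd
        · rfl
        have h1 := (isProfile_sibling x hcd).sum_mul_childSum_eq_zero hK
          (h _ _ (isProfile_sibling x hcd)) j
        have hmem : ∀ c : Fin K, c :: x ∈ level K (x.length + 1) := fun c => mem_level.2 rfl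
        have h2 : ∀ u ∈ level K (x.length + 1),
            (siblingProfile x c d u : ℂ) * childSum^[j] χ u =
            ((if u = c :: x then childSum^[j] χ u else 0) -
              if u = d :: x then childSum^[j] χ u else 0) / (√2 : ℝ) := fun u hu => by
          rw [mem_level] at hu
          simp only [siblingProfile, cons_suffix_iff_of_length _ hu]
          split_ifs <;> push_cast <;> ring
        rw [Finset.sum_congr rfl h2, ← Finset.sum_div, Finset.sum_sub_distrib, Finset.sum_ite_eq',
          Finset.sum_ite_eq', if_pos (hmem c), if_pos (hmem d), div_eq_zero_iff] at h1
        have h3 : ((√2 : ℝ) : ℂ) ≠ 0 := by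
          exact_mod_cast (Real.sqrt_pos.2 two_pos).ne'
        exact (sub_eq_zero.1 (h1.resolve_right h3)).symm
      have h1 := ih (j + 1)
      rw [Function.iterate_succ_apply', childSum, Finset.sum_congr rfl fun d _ => hsib d,
        Finset.sum_const, Finset.card_univ, Fintype.card_fin, nsmul_eq_mul] at h1
      exact (mul_eq_zero.1 h1).resolve_left (by exact_mod_cast hK.ne')
  refine lp.ext ?_
  funext u
  exact hall u 0

end Tree

/-! ### Scaling of measures on the line -/

section Scaling

lemma support_map_const_mul {s : ℝ} {μ : Measure ℝ} {t : ℝ} (ht : t ∈ μ.support) :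
    s * t ∈ (μ.map fun t => s * t).support := by
  rw [Measure.mem_support_iff_forall] at ht ⊢
  intro U hU
  have hc : Continuous fun t : ℝ => s * t := by fun_prop
  have h1 := ht _ (hc.continuousAt.preimage_mem_nhds hU)
  exact h1.trans_le (Measure.le_map_apply (by fun_prop) _)

lemma absolutelyContinuous_map_const_mul_iff {s : ℝ} (hs : 0 < s) {μ : Measure ℝ} :
    μ.map (fun t => s * t) ≪ volume ↔ μ ≪ volume := by
  have hm : ∀ r : ℝ, Measurable fun t : ℝ => r * t := fun r => by fun_prop
  have hvol : ∀ r : ℝ, r ≠ 0 → (volume.map fun t : ℝ => r * t) ≪ volume := fun r hr => by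
    rw [Real.map_volume_mul_left hr]
    exact Measure.smul_absolutelyContinuous
  refine ⟨fun h => ?_, fun h => (h.map (hm s)).trans (hvol s hs.ne')⟩
  have h1 := (h.map (hm s⁻¹)).trans (hvol s⁻¹ (inv_ne_zero hs.ne'))
  rw [Measure.map_map (hm _) (hm _)] at h1
  have h2 : (fun t : ℝ => s⁻¹ * t) ∘ (fun t => s * t) = id := by
    funext t
    exact inv_mul_cancel_left₀ hs.ne' t
  rwa [h2, Measure.map_id] at h1

lemma mutuallySingular_map_const_mul {s : ℝ} (hs : 0 < s) {μ : Measure ℝ} (h : μ ⟂ₘ volume) :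
    (μ.map fun t => s * t) ⟂ₘ volume := by
  have hm : ∀ r : ℝ, Measurable fun t : ℝ => r * t := fun r => by fun_prop
  obtain ⟨B, hB, h1, h2⟩ := h
  have hpre : ∀ C : Set ℝ, (fun t => s * t) ⁻¹' ((fun t => s⁻¹ * t) ⁻¹' C) = C := fun C => by
    ext t
    simp [inv_mul_cancel_left₀ hs.ne']
  refine ⟨(fun t => s⁻¹ * t) ⁻¹' B, hm _ hB, ?_, ?_⟩
  · rw [Measure.map_apply (hm s) (hm _ hB), hpre, h1]
  · rw [← Set.preimage_compl, Real.volume_preimage_mul_left (inv_ne_zero hs.ne'), h2, mul_zero]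

lemma isClosed_image_const_mul {s : ℝ} (hs : 0 < s) {C : Set ℝ} (hC : IsClosed C) :
    IsClosed ((fun t => s * t) '' C) :=
  (Homeomorph.mulLeft₀ s hs.ne').isClosedMap C hC

lemma image_const_mul_closure_subset {s : ℝ} {B C : Set ℝ} (hC : IsClosed C)
    (h : ∀ t ∈ B, s * t ∈ C) : (fun t => s * t) '' closure B ⊆ C := by
  have hc : Continuous fun t : ℝ => s * t := by fun_prop
  exact (image_closure_subset_closure_image hc).trans
    (closure_minimal (Set.image_subset_iff.2 h) hC)

end Scaling

/-! ### The spectra of the tree and of the half-line -/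

theorem lemma2p1 (K : ℕ) (hK : 2 ≤ K) (V : List (Fin K) → ℝ) (v : ℕ → ℝ)
    (hV : ∀ x : List (Fin K), V x = v x.length) :
    acSpectrum (schrodinger (rootedTree K) V) =
        (fun t : ℝ => Real.sqrt K * t) ''
          acSpectrum (schrodinger halfLine fun n => v n / Real.sqrt K) ∧
      (fun t : ℝ => Real.sqrt K * t) ''
          singSpectrum (schrodinger halfLine fun n => v n / Real.sqrt K) ⊆
        singSpectrum (schrodinger (rootedTree K) V) := by
  have hK0 : 0 < K := by omega
  have hs : 0 < Real.sqrt K := Real.sqrt_pos.2 (by exact_mod_cast hK0)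
  have hA := isSelfAdjointOp_rootedTree V
  set s := Real.sqrt K with hs_def
  let q : ℕ → ℝ := fun n => v n / s
  have hB := isSelfAdjointOp_halfLine q
  -- the radial subspace
  have hJ : Intertwines (schrodinger (rootedTree K) V) (schrodinger halfLine q) s
      (isProfile_one.isometry hK0) := by
    have := isProfile_one.intertwines hK0 hV
    simpa only [zero_add] using this
  refine ⟨Set.Subset.antisymm ?_ ?_, ?_⟩
  · refine closure_minimal ?_ (isClosed_image_const_mul hs isClosed_closure)
    rintro t ⟨ψ, μ, hμ, hac, ht⟩
    by_contra hnot
    set O : Set ℝ := ((fun t => s * t) '' acSpectrum (schrodinger halfLine q))ᶜ with hO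
    have hOopen : IsOpen O := (isClosed_image_const_mul hs isClosed_closure).isOpen_compl
    have hpos : 0 < μ O := (Measure.mem_support_iff_forall t).1 ht O (hOopen.mem_nhds hnot)
    -- the part of `ψ` in the spectral subspace of `O`
    obtain ⟨χ, hχ⟩ := hA.exists_isSpectralMeasure_restrict hμ hOopen.measurableSet
    have hχac : μ.restrict O ≪ volume :=
      (Measure.absolutelyContinuous_of_le Measure.restrict_le_self).trans hac
    -- each of its half-line components has an absolutely continuous spectral measure living where the
    -- half-line operator has no absolutely continuous spectrum
    have hχ0 : χ = 0 := by
      refine eq_zero_of_adjoint_isometry_eq_zero hK0 fun n a ha => ?_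
      have hBn := isSelfAdjointOp_halfLine fun j => q (n + j)
      obtain ⟨ν, hν⟩ :=
        hBn.exists_isSpectralMeasure ((ha.isometry hK0).toContinuousLinearMap.adjoint χ)
      obtain ⟨ν₀, hν₀⟩ := hBn.exists_isSpectralMeasure (delta 0)
      have hle := (ha.intertwines hK0 hV).spectralMeasure_map_adjoint_le hA hBn hs hχ hν
      have hνac : ν ≪ volume := (absolutelyContinuous_map_const_mul_iff hs).1
        ((Measure.absolutelyContinuous_of_le hle).trans hχac)
      have hS : MeasurableSet (acSpectrum (schrodinger halfLine q))ᶜ :=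
        isClosed_closure.measurableSet.compl
      have h1 : ν (acSpectrum (schrodinger halfLine q))ᶜ = 0 :=
        measure_eq_zero_of_ae_rnDeriv_eq_zero hν₀ hS (ae_rnDeriv_shift_eq_zero q n hν₀) hν hνac
      have h2 : ν (acSpectrum (schrodinger halfLine q)) = 0 := by
        have hOc : MeasurableSet Oᶜ := hOopen.measurableSet.compl
        have h3 : ν.map (fun t => s * t) Oᶜ = 0 := by
          refine le_antisymm ((hle Oᶜ).trans ?_) zero_le
          rw [Measure.restrict_apply hOc, Set.compl_inter_self, measure_empty]
        rw [Measure.map_apply (by fun_prop) hOc, hO, compl_compl,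
          Set.preimage_image_eq _ (mul_right_injective₀ hs.ne')] at h3
        exact h3
      have hν0 : ν = 0 := by
        rw [← Measure.measure_univ_eq_zero,
          ← Set.union_compl_self (acSpectrum (schrodinger halfLine q))]
        exact measure_union_null h2 h1
      rw [hν0] at hν
      exact hBn.eq_zero_of_isSpectralMeasure_zero hν
    rw [hχ0] at hχ
    have h0 := hA.isSpectralMeasure_unique hχ hA.isSpectralMeasure_zero
    exact hpos.ne' (Measure.restrict_eq_zero.1 h0)
  · refine image_const_mul_closure_subset isClosed_closure ?_
    rintro t ⟨ψ, μ, hμ, hac, ht⟩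
    exact subset_closure ⟨_, _, hJ.isSpectralMeasure_map hA hB hs hμ,
      (absolutelyContinuous_map_const_mul_iff hs).2 hac, support_map_const_mul ht⟩
  · refine image_const_mul_closure_subset isClosed_closure ?_
    rintro t ⟨ψ, μ, hμ, hsing, ht⟩
    exact subset_closure ⟨_, _, hJ.isSpectralMeasure_map hA hB hs hμ,
      mutuallySingular_map_const_mul hs hsing, support_map_const_mul ht⟩
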